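/- Let $(X_i)$ and $(Y_j)$ be two (finite or infinite) sequences of random variables with values in $[0,1]$ such that $$\sum_i X_i+\sum_j Y_j=1\ \text{ a.s.},\qquad \mathbb E\Big[\sum_i X_i\Big]<1,\qquad \mathbb E\big[\#\{i: X_i>0\}\big]>1 .$$ Start with one crumb of size $1$. Recursively, each crumb of size $\xi$ splits into crumbs of sizes $\xi X'_i$ and solids of sizes $\xi Y'_j$, where $(X',Y')$ is a copy of $(X,Y)$ and the copies used for different crumbs are independent. Solids are not split further. Let $P=(P_c)$ be the family of the sizes of all solids ever produced (a.s. $\sum_c P_c=1$). Conditionally given $P$, balls $1,2,\dots$ are painted independently, each with colour $c$ with probability $P_c$. Let $K_n$ be the number of different colours of the first $n$ balls, and $K_{nr}$ the number of colours represented exactly $r$ times among them. Put $\psi(s)=\mathbb E\big[\sum_{i:X_i>0}X_i^{s}\big]$ and $\varphi(s)=\mathbb E\big[\sum_{j:Y_j>0}Y_j^{s}\big]$ for complex $s$ for which the expectations converge absolutely. Suppose (Malthusian hypothesis) that $\alpha_*\in\mathbb R$ and $\varepsilon>0$ are such that $\psi$ converges absolutely in the half-plane $\{\operatorname{Re}s>\alpha_*-\varepsilon\}$,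 $\alpha_*$ is the unique solution of $\psi(s)=1$ in this half-plane, and $\varphi(\alpha_*-\varepsilon)<\infty$. Then $0<\alpha_*<1$, $\psi$ is differentiable at $\alpha_*$ with $\psi'(\alpha_*)\neq0$, and, as $n\to\infty$, $$\mathbb E[K_n]=n^{\alpha_*}\,\frac{\Gamma(-\alpha_*)\,\varphi(\alpha_*)}{\psi'(\alpha_*)}+O\big(n^{\alpha_*-\delta}\big)\qquad\text{for every }\delta\in(0,\varepsilon)\text{ with }\delta\le\alpha_*,$$ and, for every fixed integer $r\ge1$, $$\mathbb E[K_{nr}]=n^{\alpha_*}\,\frac{\Gamma(r-\alpha_*)\,\varphi(\alpha_*)}{-\,r!\,\psi'(\alpha_*)}+O\big(n^{\alpha_*-\delta}\big)\qquad\text{for every }\delta\in(0,\varepsilon)\text{ with }\delta\le1 .$$ -/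

import Mathlib

open MeasureTheory ProbabilityTheory Filter Asymptotics
open scoped ENNReal

namespace RecursivePartition

/-- The standing assumptions on the random splitting `(X, Y)` of the unit: `X i` are the relative
sizes of crumbs, `Y j` those of solids. A size `0` means that there is no piece with this label, so
finite sequences and sequences labelled by (possibly random) subsets of `ℕ` are covered. -/
structure IsSplitting {Ω₀ : Type*} [MeasurableSpace Ω₀] (P₀ : Measure Ω₀)
    (X Y : ℕ → Ω₀ → ℝ) : Prop where
  measurable_X : ∀ i, Measurable (X i)
  measurable_Y : ∀ j, Measurable (Y j)
  mem_Icc_X : ∀ᵐ ω ∂P₀, ∀ i, X i ω ∈ Set.Icc (0 : ℝ) 1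
  mem_Icc_Y : ∀ᵐ ω ∂P₀, ∀ j, Y j ω ∈ Set.Icc (0 : ℝ) 1
  sum_eq_one : ∀ᵐ ω ∂P₀,
    ∑' i, ENNReal.ofReal (X i ω) + ∑' j, ENNReal.ofReal (Y j ω) = 1
  mean_crumbs_lt_one : ∫⁻ ω, ∑' i, ENNReal.ofReal (X i ω) ∂P₀ < 1
  supercritical : 1 < ∫⁻ ω, (({i | 0 < X i ω} : Set ℕ).encard : ℝ≥0∞) ∂P₀

/-- The intensity measure of the point process of the positive terms among `Z 0, Z 1, …`: for
measurable `f ≥ 0`, its integral of `f` is the mean of the sum of `f (Z i)` over `i` with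
`Z i > 0`. -/
noncomputable def intensity {Ω₀ : Type*} [MeasurableSpace Ω₀] (P₀ : Measure Ω₀)
    (Z : ℕ → Ω₀ → ℝ) : Measure ℝ :=
  (Measure.sum fun i => P₀.map (Z i)).restrict (Set.Ioi 0)

/-- The Mellin transform `s ↦ ∫ x ^ s m(dx)` of a measure, as a function of a complex variable. -/
noncomputable def mellinTransform (m : Measure ℝ) (s : ℂ) : ℂ :=
  ∫ x : ℝ, (x : ℂ) ^ s ∂m

/-- The Malthusian hypothesis with exponent `α` and width `ε`, for the intensity measures `σ` of
crumbs and `ν` of solids, whose Mellin transforms are `ψ` and `φ`. The transform `ψ` converges in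
the open half-plane `Re s > α - ε`, where `α` is the only solution of `ψ s = 1`, and
`φ (α - ε) < ∞`. -/
structure Malthusian (σ ν : Measure ℝ) (α ε : ℝ) : Prop where
  eps_pos : 0 < ε
  psi_finite : ∀ a : ℝ, α - ε < a → Integrable (fun x : ℝ => x ^ a) σ
  psi_eq_one : mellinTransform σ (α : ℂ) = 1
  unique : ∀ s : ℂ, α - ε < s.re → mellinTransform σ s = 1 → s = (α : ℂ)
  phi_finite : Integrable (fun x : ℝ => x ^ (α - ε)) ν

/-- A realization of the relative splittings of all crumbs. Crumbs are labelled by words, with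
the most recent letter first: `i :: u` is the child number `i` of `u`. The pair `S u ω` gives the
relative sizes of the crumbs and of the solids into which the crumb `u` splits; these pairs are
independent copies of `(X, Y)`. -/
structure IsDivision {Ω₀ Ω : Type*} [MeasurableSpace Ω₀] [MeasurableSpace Ω] (P₀ : Measure Ω₀)
    (X Y : ℕ → Ω₀ → ℝ) (μ : Measure Ω) (S : List ℕ → Ω → (ℕ → ℝ) × (ℕ → ℝ)) : Prop where
  measurable : ∀ u, Measurable (S u)
  indep : iIndepFun S μ
  identDistrib : ∀ u, IdentDistrib (S u) (fun ω => (fun i => X i ω, fun j => Y j ω)) μ P₀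

/-- The size of the crumb with label `u`. -/
def crumb {Ω : Type*} (S : List ℕ → Ω → (ℕ → ℝ) × (ℕ → ℝ)) : List ℕ → Ω → ℝ
  | [], _ => 1
  | i :: u, ω => crumb S u ω * (S u ω).1 i

/-- The size of the solid with label `(u, j)`, the solid number `j` born from the crumb `u`.
The family of all these sizes is the paintbox. -/
def solid {Ω : Type*} (S : List ℕ → Ω → (ℕ → ℝ) × (ℕ → ℝ)) (c : List ℕ × ℕ) (ω : Ω) : ℝ :=
  crumb S c.1 ω * (S c.1 ω).2 c.2

/-- The random colours `C 0, C 1, …` of the balls are a sample from the random frequencies `P`: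
conditionally given `P`, they are independent, and each is `c` with probability `P c`. -/
structure IsPaintboxSample {Ω κ : Type*} [MeasurableSpace Ω] (μ : Measure Ω)
    (P : κ → Ω → ℝ) (C : ℕ → Ω → κ) : Prop where
  measurable_box : ∀ c, Measurable (P c)
  measurableSet_color : ∀ k c, MeasurableSet {ω | C k ω = c}
  cond_law : ∀ (n : ℕ) (c : Fin n → κ),
    μ⟦{ω | ∀ k : Fin n, C k ω = c k} |
        MeasurableSpace.comap (fun ω d => P d ω) MeasurableSpace.pi⟧
      =ᵐ[μ] fun ω => ∏ k, P (c k) ω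

/-- `K_n`: the number of different colours of the first `n` balls. -/
def numColors {Ω κ : Type*} [DecidableEq κ] (C : ℕ → Ω → κ) (n : ℕ) (ω : Ω) : ℕ :=
  ((Finset.range n).image fun k => C k ω).card

/-- `K_{nr}` for `r ≥ 1`: the number of colours represented exactly `r` times on the first `n`
balls. -/
def numColorsMult {Ω κ : Type*} [DecidableEq κ] (C : ℕ → Ω → κ) (n r : ℕ) (ω : Ω) : ℕ :=
  (((Finset.range n).image fun k => C k ω).filter fun c =>
    ((Finset.range n).filter fun k => C k ω = c).card = r).card

end RecursivePartition

open RecursivePartition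

namespace RecursivePartition

/-!
Let `m` be the intensity of the solids, `m s = E #{c | P_c ∈ s}`. Every crumb but the first is a
fraction of its parent, a renewal equation by which the Mellin transform of `m` is `φ / (1 - ψ)` to
the right of `α`. It continues meromorphically to `Re s > α - ε`, with a single pole, at `α`, which
is simple since `ψ' (α) = E ∑ X_i ^ α log X_i < 0`. Mellin inversion and a shift of the contour
across `α` show that `∫ (t x) ^ r exp (-t x) m(dx)` is `t ^ α` times an explicit constant, up to
`O(t ^ (α - δ))`. For the shift, `1 - ψ` must stay away from `0` on vertical lines far from the real
axis: by Harnack's inequality for `log |1 - ψ|`, its size there is comparable to its size further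
right, where `|ψ|` is less than `1`. Replacing the Poisson weights by the binomial weights of `n`
balls costs a relative error `1 / n`, which gives `E K_{nr}`; and `E K_n` is the sum, over the first
`n` balls, of the probability that the ball shows a new colour.
-/

theorem norm_sub_le_of_forall_re_sub_le {F : ℂ → ℂ} {c z : ℂ} {L r R : ℝ} (hL : 0 < L) (hrR : r < R)
    (hF : DifferentiableOn ℂ F (Metric.ball c R))
    (hre : ∀ w ∈ Metric.ball c R, (F w - F c).re ≤ L) (hz : z ∈ Metric.closedBall c r) :
    ‖F z - F c‖ ≤ 2 * L * r / (R - r) := by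
  have hR : 0 < R := (dist_nonneg.trans hz).trans_lt hrR
  have hmaps : Set.MapsTo (c + ·) (Metric.ball (0 : ℂ) R) (Metric.ball c R) := fun w hw => by
    simpa using hw
  have hzc : ‖z - c‖ ≤ r := by simpa [dist_eq_norm] using hz
  have hBC : ‖F z - F c‖ ≤ 2 * L * ‖z - c‖ / (R - ‖z - c‖) := by
    simpa using Complex.borelCaratheodory_zero (f := fun w => F (c + w) - F c) (z := z - c) hL
      ((hF.comp (by fun_prop) hmaps).sub_const _) (fun w hw => hre _ (hmaps hw)) hR
      (by simpa using hzc.trans_lt hrR) (by simp)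
  refine hBC.trans ?_
  have := sub_pos.mpr hrR
  have hr : 0 ≤ r := (norm_nonneg _).trans hzc
  gcongr

-- `log ‖f‖` is the real part of a holomorphic function, to which Borel–Carathéodory applies.
theorem le_norm_of_forall_mem_ball_ne_zero {f : ℂ → ℂ} {c z : ℂ} {M m r R : ℝ} (hm : 0 < m)
    (hrR : r < R) (hf : DifferentiableOn ℂ f (Metric.ball c R))
    (hf0 : ∀ w ∈ Metric.ball c R, f w ≠ 0) (hfM : ∀ w ∈ Metric.ball c R, ‖f w‖ ≤ M)
    (hfc : m ≤ ‖f c‖) (hz : z ∈ Metric.closedBall c r) :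
    m * Real.exp (-(2 * (|Real.log (M / m)| + 1) * r / (R - r))) ≤ ‖f z‖ := by
  have hR : 0 < R := (dist_nonneg.trans hz).trans_lt hrR
  have hcR : c ∈ Metric.ball c R := Metric.mem_ball_self hR
  have hzR : z ∈ Metric.ball c R := lt_of_le_of_lt hz hrR
  have hM : 0 < M := hm.trans_le (hfc.trans (hfM c hcR))
  set L := |Real.log (M / m)| + 1 with hL
  obtain ⟨F, hF, hFre⟩ :=
    InnerProductSpace.HarmonicOnNhd.exists_analyticOnNhd_ball_re_eq fun w hw =>
      ((hf.analyticAt (Metric.isOpen_ball.mem_nhds hw)).harmonicAt_log_norm (hf0 w hw))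
  replace hFre : ∀ w ∈ Metric.ball c R, (F w).re = Real.log ‖f w‖ := hFre
  have hre : ∀ w ∈ Metric.ball c R, (F w - F c).re ≤ L := by
    intro w hw
    rw [Complex.sub_re, hFre w hw, hFre c hcR]
    have hfw := Real.log_le_log (norm_pos_iff.mpr (hf0 w hw)) (hfM w hw)
    have hfc' := Real.log_le_log hm hfc
    have hMm := le_abs_self (Real.log (M / m))
    rw [Real.log_div hM.ne' hm.ne'] at hL hMm
    linarith
  have hbound : ‖F z - F c‖ ≤ 2 * L * r / (R - r) :=
    norm_sub_le_of_forall_re_sub_le (by positivity) hrR hF.differentiableOn hre hz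
  have hlog : Real.log m - 2 * L * r / (R - r) ≤ Real.log ‖f z‖ := by
    have hre_ge := (abs_le.mp (Complex.abs_re_le_norm (F z - F c))).1
    rw [Complex.sub_re, hFre z hzR, hFre c hcR] at hre_ge
    linarith [Real.log_le_log hm hfc]
  calc m * Real.exp (-(2 * L * r / (R - r)))
      = Real.exp (Real.log m - 2 * L * r / (R - r)) := by
        rw [sub_eq_add_neg (Real.log m), Real.exp_add, Real.exp_log hm]
    _ ≤ Real.exp (Real.log ‖f z‖) := Real.exp_le_exp.mpr hlog
    _ = ‖f z‖ := Real.exp_log (norm_pos_iff.mpr (hf0 z hzR))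

theorem integrable_vertical {F : ℂ → ℂ} {a C : ℝ}
    (hF : ∀ z : ℂ, z.re = a → ContinuousAt F z)
    (hC : ∀ z : ℂ, z.re = a → ‖F z‖ ≤ C / (1 + z.im ^ 2)) :
    Integrable fun y : ℝ => F (a + y * Complex.I) := by
  have hbound : Integrable fun y : ℝ => C / (1 + y ^ 2) := by
    simpa only [div_eq_mul_inv] using integrable_inv_one_add_sq.const_mul C
  refine hbound.mono' ?_ (ae_of_all _ fun y => ?_)
  · refine (continuous_iff_continuousAt.mpr fun y => ?_).aestronglyMeasurable
    exact ContinuousAt.comp (f := fun y : ℝ => (a + y * Complex.I : ℂ)) (hF _ (by simp))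
      (by fun_prop)
  · simpa using hC (a + y * Complex.I) (by simp)

theorem tendsto_intervalIntegral_horizontal {F : ℂ → ℂ} {a b C : ℝ} (hab : a ≤ b)
    (hC : ∀ z : ℂ, a ≤ z.re → z.re ≤ b → ‖F z‖ ≤ C / (1 + z.im ^ 2)) :
    Tendsto (fun T : ℝ => ∫ x in a..b, F (x + T * Complex.I)) (cocompact ℝ) (nhds 0) := by
  have hlim : Tendsto (fun T : ℝ => C / (1 + T ^ 2) * |b - a|) (cocompact ℝ) (nhds 0) := by
    have hsq : Tendsto (fun T : ℝ => 1 + T ^ 2) (cocompact ℝ) atTop := by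
      simpa only [Function.comp_def, Real.norm_eq_abs, sq_abs] using
        tendsto_atTop_add_const_left _ 1
          ((tendsto_pow_atTop two_ne_zero).comp (tendsto_norm_cocompact_atTop (E := ℝ)))
    simpa using (hsq.const_div_atTop C).mul_const |b - a|
  refine squeeze_zero_norm (fun T => ?_) hlim
  refine intervalIntegral.norm_integral_le_of_norm_le_const fun x hx => ?_
  rw [Set.uIoc_of_le hab] at hx
  simpa using hC (x + T * Complex.I) (by simpa using hx.1.le) (by simpa using hx.2)

theorem intervalIntegral_vertical_sub {F : ℂ → ℂ} {a b : ℝ} (hab : a ≤ b)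
    (hF : ∀ z : ℂ, a ≤ z.re → z.re ≤ b → DifferentiableAt ℂ F z) (T : ℝ) :
    (∫ y in (-T)..T, F (b + y * Complex.I)) - ∫ y in (-T)..T, F (a + y * Complex.I) =
      Complex.I * ((∫ x in a..b, F (x + (-T : ℝ) * Complex.I)) -
        ∫ x in a..b, F (x + T * Complex.I)) := by
  have hrect := Complex.integral_boundary_rect_eq_zero_of_differentiableOn F
    (a + (-T : ℝ) * Complex.I) (b + T * Complex.I) fun z hz => by
      have hz_re : z.re ∈ Set.Icc a b := by simpa [Set.uIcc_of_le hab] using hz.1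
      exact (hF z hz_re.1 hz_re.2).differentiableWithinAt
  simp only [Complex.add_re, Complex.ofReal_re, Complex.mul_re, Complex.I_re, mul_zero,
    Complex.ofReal_im, Complex.I_im, mul_one, sub_self, add_zero, Complex.add_im,
    Complex.mul_im, zero_add, smul_eq_mul] at hrect
  linear_combination (-Complex.I) * hrect + ((∫ y in (-T)..T, F (b + y * Complex.I)) -
    ∫ y in (-T)..T, F (a + y * Complex.I)) * Complex.I_mul_I

theorem integral_vertical_eq {F : ℂ → ℂ} {a b C : ℝ} (hab : a ≤ b)
    (hF : ∀ z : ℂ, a ≤ z.re → z.re ≤ b → DifferentiableAt ℂ F z)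
    (hC : ∀ z : ℂ, a ≤ z.re → z.re ≤ b → ‖F z‖ ≤ C / (1 + z.im ^ 2)) :
    ∫ y : ℝ, F (a + y * Complex.I) = ∫ y : ℝ, F (b + y * Complex.I) := by
  have hline : ∀ d ∈ Set.Icc a b, Tendsto (fun T : ℝ => ∫ y in (-T)..T, F (d + y * Complex.I))
      atTop (nhds (∫ y : ℝ, F (d + y * Complex.I))) := fun d hd =>
    intervalIntegral_tendsto_integral
      (integrable_vertical (C := C) (fun z hz => (hF z (hz ▸ hd.1) (hz ▸ hd.2)).continuousAt)
        fun z hz => hC z (hz ▸ hd.1) (hz ▸ hd.2)) tendsto_neg_atTop_atBot tendsto_id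
  have hsub := (hline b ⟨hab, le_rfl⟩).sub (hline a ⟨le_rfl, hab⟩)
  simp only [intervalIntegral_vertical_sub hab hF] at hsub
  have hhor := tendsto_intervalIntegral_horizontal hab hC
  have hzero := (((hhor.mono_left atBot_le_cocompact).comp tendsto_neg_atTop_atBot).sub
    (hhor.mono_left atTop_le_cocompact)).const_mul Complex.I
  rw [sub_zero, mul_zero] at hzero
  exact (sub_eq_zero.mp (tendsto_nhds_unique hsub hzero)).symm

theorem differentiableAt_Gamma_of_re_pos {z : ℂ} (hz : 0 < z.re) :
    DifferentiableAt ℂ Complex.Gamma z :=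
  Complex.differentiableAt_Gamma z fun n hn => by
    have hz_neg : z.re = -(n : ℝ) := by simp [hn]
    linarith [(n.cast_nonneg : (0 : ℝ) ≤ n)]

theorem norm_Gamma_le_Gamma_re {z : ℂ} (hz : 0 < z.re) : ‖Complex.Gamma z‖ ≤ Real.Gamma z.re := by
  rw [Complex.Gamma_eq_integral hz, Complex.GammaIntegral, Real.Gamma_eq_integral hz]
  refine norm_integral_le_of_norm_le (Real.GammaIntegral_convergent hz) ?_
  refine (ae_restrict_iff' measurableSet_Ioi).mpr (ae_of_all _ fun x hx => ?_)
  rw [norm_mul, Complex.norm_cpow_eq_rpow_re_of_pos hx]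
  simp [Complex.norm_exp]

theorem exists_norm_Gamma_le {a : ℝ} (ha : 0 < a) (b : ℝ) :
    ∃ B, ∀ z : ℂ, a ≤ z.re → z.re ≤ b → ‖Complex.Gamma z‖ ≤ B := by
  have hcont : ContinuousOn Real.Gamma (Set.Icc a b) := fun x hx =>
    (Real.differentiableAt_Gamma fun m => by
      linarith [hx.1, (m.cast_nonneg : (0 : ℝ) ≤ m)]).continuousAt.continuousWithinAt
  obtain ⟨B, hB⟩ := isCompact_Icc.exists_bound_of_continuousOn hcont
  exact ⟨B, fun z hza hzb => (norm_Gamma_le_Gamma_re (ha.trans_le hza)).trans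
    ((le_abs_self _).trans (hB z.re ⟨hza, hzb⟩))⟩

-- Two steps of the functional equation trade boundedness of `Γ (z + 2)` for quadratic decay.
theorem exists_norm_Gamma_le_div {a : ℝ} (ha : 0 < a) (b : ℝ) :
    ∃ C, ∀ z : ℂ, a ≤ z.re → z.re ≤ b → ‖Complex.Gamma z‖ ≤ C / (1 + z.im ^ 2) := by
  obtain ⟨B, hB⟩ := exists_norm_Gamma_le (a := a + 2) (by positivity) (b + 2)
  have : 0 < min (a ^ 2) 1 := by positivity
  refine ⟨B / min (a ^ 2) 1, fun z hza hzb => ?_⟩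
  have hz0 : z ≠ 0 := by rintro rfl; simp only [Complex.zero_re] at hza; linarith
  have hz1 : z + 1 ≠ 0 := fun h => by
    have hre := congrArg Complex.re h
    simp only [Complex.add_re, Complex.one_re, Complex.zero_re] at hre
    linarith
  have hrec : Complex.Gamma (z + 2) = (z + 1) * (z * Complex.Gamma z) := by
    rw [← Complex.Gamma_add_one z hz0, ← Complex.Gamma_add_one _ hz1]; ring_nf
  have hsq : min (a ^ 2) 1 * (1 + z.im ^ 2) ≤ ‖z‖ ^ 2 := by
    rw [Complex.sq_norm, Complex.normSq_apply]
    nlinarith [sq_nonneg z.im, min_le_left (a ^ 2) 1, min_le_right (a ^ 2) 1]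
  have hle : ‖z‖ ≤ ‖z + 1‖ := by
    rw [← sq_le_sq₀ (norm_nonneg _) (norm_nonneg _), Complex.sq_norm, Complex.sq_norm,
      Complex.normSq_apply, Complex.normSq_apply]
    simp only [Complex.add_re, Complex.one_re, Complex.add_im, Complex.one_im]
    nlinarith
  rw [div_div, le_div_iff₀ (by positivity)]
  calc ‖Complex.Gamma z‖ * (min (a ^ 2) 1 * (1 + z.im ^ 2))
      ≤ ‖Complex.Gamma z‖ * (‖z + 1‖ * ‖z‖) := by
        refine mul_le_mul_of_nonneg_left ?_ (norm_nonneg _)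
        nlinarith [norm_nonneg z]
    _ = ‖Complex.Gamma (z + 2)‖ := by rw [hrec, norm_mul, norm_mul]; ring
    _ ≤ B := hB _ (by simpa using hza) (by simpa using hzb)

theorem integrable_vertical_Gamma {a : ℝ} (ha : 0 < a) :
    Integrable fun y : ℝ => Complex.Gamma (a + y * Complex.I) := by
  obtain ⟨C, hC⟩ := exists_norm_Gamma_le_div ha a
  exact integrable_vertical (fun z hz => (differentiableAt_Gamma_of_re_pos
    (hz ▸ ha)).continuousAt) fun z hz => hC z hz.ge hz.le

theorem exp_neg_eq_integral_Gamma {a x : ℝ} (ha : 0 < a) (hx : 0 < x) :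
    ((Real.exp (-x) : ℝ) : ℂ) = (1 / (2 * Real.pi) : ℝ) *
      ∫ y : ℝ, (x : ℂ) ^ (-(a + y * Complex.I)) * Complex.Gamma (a + y * Complex.I) := by
  have hmellin : ∀ y : ℝ, mellin (fun x : ℝ => ((Real.exp (-x) : ℝ) : ℂ)) (a + y * Complex.I) =
      Complex.Gamma (a + y * Complex.I) := fun y => by
    rw [Complex.Gamma_eq_integral (by simpa using ha), Complex.GammaIntegral_eq_mellin]
  have hconv : MellinConvergent (fun x : ℝ => ((Real.exp (-x) : ℝ) : ℂ)) a :=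
    (Complex.GammaIntegral_convergent (s := a) (by simpa using ha)).congr_fun
      (fun x _ => mul_comm _ _) measurableSet_Ioi
  rw [← mellinInv_mellin_eq a (fun x : ℝ => ((Real.exp (-x) : ℝ) : ℂ)) hx hconv
    (by simpa only [Complex.VerticalIntegrable, hmellin] using integrable_vertical_Gamma ha)
    (by fun_prop), mellinInv]
  simp only [hmellin, smul_eq_mul]
  rw [Complex.real_smul]

theorem pow_mul_exp_neg_eq_integral_Gamma {c x : ℝ} {r : ℕ} (hcr : c < r) (hx : 0 < x) :
    ((x ^ r * Real.exp (-x) : ℝ) : ℂ) = (1 / (2 * Real.pi) : ℝ) *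
      ∫ y : ℝ, (x : ℂ) ^ (c + y * Complex.I) * Complex.Gamma (r - (c + y * Complex.I)) := by
  have hx0 : (x : ℂ) ≠ 0 := by exact_mod_cast hx.ne'
  rw [Complex.ofReal_mul, exp_neg_eq_integral_Gamma (sub_pos.mpr hcr) hx, mul_left_comm,
    ← integral_const_mul, ← integral_neg_eq_self]
  congr 2 with y
  have hpow : ((x ^ r : ℝ) : ℂ) = (x : ℂ) ^ (r : ℂ) := by simp
  rw [hpow, ← mul_assoc, ← Complex.cpow_add _ _ hx0]
  congr 2 <;> push_cast <;> ring

section MellinTransform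

variable {m : Measure ℝ}

theorem integrable_rpow_of_le (hm : ∀ᵐ x ∂m, x ∈ Set.Ioc (0 : ℝ) 1) {a b : ℝ} (hab : a ≤ b)
    (ha : Integrable (fun x : ℝ => x ^ a) m) : Integrable (fun x : ℝ => x ^ b) m := by
  refine ha.mono' (by fun_prop) ?_
  filter_upwards [hm] with x hx
  rw [Real.norm_of_nonneg (Real.rpow_nonneg hx.1.le _)]
  exact Real.rpow_le_rpow_of_exponent_ge hx.1 hx.2 hab

theorem integral_rpow_anti (hm : ∀ᵐ x ∂m, x ∈ Set.Ioc (0 : ℝ) 1) {a b : ℝ} (hab : a ≤ b)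
    (ha : Integrable (fun x : ℝ => x ^ a) m) : ∫ x, x ^ b ∂m ≤ ∫ x, x ^ a ∂m := by
  refine integral_mono_ae (integrable_rpow_of_le hm hab ha) ha ?_
  filter_upwards [hm] with x hx
  exact Real.rpow_le_rpow_of_exponent_ge hx.1 hx.2 hab

theorem norm_mellinTransform_le (hm : ∀ᵐ x ∂m, 0 < x) (s : ℂ) :
    ‖mellinTransform m s‖ ≤ ∫ x, x ^ s.re ∂m := by
  refine (norm_integral_le_integral_norm _).trans_eq (integral_congr_ae ?_)
  filter_upwards [hm] with x hx using Complex.norm_cpow_eq_rpow_re_of_pos hx s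

theorem mellinTransform_ofReal (hm : ∀ᵐ x ∂m, 0 < x) (a : ℝ) :
    mellinTransform m a = ((∫ x, x ^ a ∂m : ℝ) : ℂ) := by
  rw [mellinTransform, ← integral_complex_ofReal]
  refine integral_congr_ae ?_
  filter_upwards [hm] with x hx
  rw [Complex.ofReal_cpow hx.le]

theorem mellinTransform_eq_complexMGF_log (hm : ∀ᵐ x ∂m, 0 < x) :
    mellinTransform m = complexMGF Real.log m := by
  ext s
  refine integral_congr_ae ?_
  filter_upwards [hm] with x hx
  rw [Complex.cpow_def_of_ne_zero (by exact_mod_cast hx.ne'), Complex.ofReal_log hx.le, mul_comm]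

theorem mem_interior_integrableExpSet_log (hm : ∀ᵐ x ∂m, 0 < x) {a₀ a : ℝ}
    (hint : ∀ b : ℝ, a₀ < b → Integrable (fun x : ℝ => x ^ b) m) (ha : a₀ < a) :
    a ∈ interior (integrableExpSet Real.log m) := by
  refine mem_interior.mpr ⟨Set.Ioi a₀, fun b hb => (hint b hb).congr ?_, isOpen_Ioi, ha⟩
  filter_upwards [hm] with x hx
  rw [Real.rpow_def_of_pos hx, mul_comm]

theorem differentiableAt_mellinTransform (hm : ∀ᵐ x ∂m, 0 < x) {a₀ : ℝ}
    (hint : ∀ b : ℝ, a₀ < b → Integrable (fun x : ℝ => x ^ b) m) {s : ℂ} (hs : a₀ < s.re) :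
    DifferentiableAt ℂ (mellinTransform m) s := by
  rw [mellinTransform_eq_complexMGF_log hm]
  exact (hasDerivAt_complexMGF
    (mem_interior_integrableExpSet_log hm hint hs)).differentiableAt

theorem ae_eq_one_of_deriv_mellinTransform_eq_zero (hm : ∀ᵐ x ∂m, x ∈ Set.Ioc (0 : ℝ) 1)
    {a₀ a : ℝ} (hint : ∀ b : ℝ, a₀ < b → Integrable (fun x : ℝ => x ^ b) m) (ha : a₀ < a)
    (hderiv : deriv (mellinTransform m) a = 0) : ∀ᵐ x ∂m, x = 1 := by
  have hpos : ∀ᵐ x ∂m, 0 < x := hm.mono fun x hx => hx.1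
  have hmem := mem_interior_integrableExpSet_log hpos hint ha
  have hintegrable : Integrable (fun x => -(Real.log x * Real.exp (a * Real.log x))) m := by
    simpa only [pow_one, Pi.neg_def] using
      (integrable_pow_mul_exp_of_mem_interior_integrableExpSet hmem 1).neg
  have hnonneg : 0 ≤ᵐ[m] fun x => -(Real.log x * Real.exp (a * Real.log x)) := by
    filter_upwards [hm] with x hx
    exact neg_nonneg.mpr
      (mul_nonpos_of_nonpos_of_nonneg (Real.log_nonpos hx.1.le hx.2) (Real.exp_pos _).le)
  have hzero : ∫ x, -(Real.log x * Real.exp (a * Real.log x)) ∂m = 0 := by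
    rw [mellinTransform_eq_complexMGF_log hpos,
      (hasDerivAt_complexMGF (X := Real.log) (μ := m) (z := a) (by simpa using hmem)).deriv]
      at hderiv
    rw [integral_neg, neg_eq_zero, ← Complex.ofReal_eq_zero, ← hderiv, ← integral_complex_ofReal]
    push_cast
    rfl
  filter_upwards [(integral_eq_zero_iff_of_nonneg_ae hnonneg hintegrable).mp hzero, hm]
    with x hx hx_mem
  exact Real.eq_one_of_pos_of_log_eq_zero hx_mem.1 (by simpa [Real.exp_ne_zero] using hx)

end MellinTransform

section MellinParseval

variable {m : Measure ℝ} {c t : ℝ} {r : ℕ}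

theorem integrable_cpow_mul_Gamma_mul_cpow (hm : ∀ᵐ x ∂m, 0 < x) (hcr : c < r) (ht : 0 < t)
    (hint : Integrable (fun x : ℝ => x ^ c) m) :
    Integrable (fun p : ℝ × ℝ => (t : ℂ) ^ (c + p.2 * Complex.I) *
      Complex.Gamma (r - (c + p.2 * Complex.I)) * (p.1 : ℂ) ^ (c + p.2 * Complex.I))
      (m.prod volume) := by
  have hΓ : Integrable fun y : ℝ => Complex.Gamma (r - (c + y * Complex.I)) := by
    convert (integrable_vertical_Gamma (sub_pos.mpr hcr)).comp_neg using 3 with y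
    push_cast; ring
  refine (hint.mul_prod (hΓ.norm.const_mul (t ^ c))).mono' ?_ ?_
  · refine (AEStronglyMeasurable.mul (Measurable.aestronglyMeasurable ?_)
      hΓ.aestronglyMeasurable.comp_snd).mul (Measurable.aestronglyMeasurable ?_)
    · exact measurable_const.pow (by fun_prop)
    · exact Measurable.pow (by fun_prop) (by fun_prop)
  · filter_upwards [Measure.quasiMeasurePreserving_fst.ae hm] with p hp
    rw [norm_mul, norm_mul, Complex.norm_cpow_eq_rpow_re_of_pos ht,
      Complex.norm_cpow_eq_rpow_re_of_pos hp]
    exact le_of_eq (by simp; ring)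

variable [SFinite m]

theorem integrable_cpow_mul_Gamma_mul_mellinTransform (hm : ∀ᵐ x ∂m, 0 < x) (hcr : c < r)
    (ht : 0 < t) (hint : Integrable (fun x : ℝ => x ^ c) m) :
    Integrable fun y : ℝ => (t : ℂ) ^ (c + y * Complex.I) *
      Complex.Gamma (r - (c + y * Complex.I)) * mellinTransform m (c + y * Complex.I) := by
  simpa only [mellinTransform, integral_const_mul] using
    (integrable_cpow_mul_Gamma_mul_cpow hm hcr ht hint).integral_prod_right

theorem integral_pow_mul_exp_neg_eq_integral_mellinTransform (hm : ∀ᵐ x ∂m, 0 < x)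
    (hcr : c < r) (ht : 0 < t) (hint : Integrable (fun x : ℝ => x ^ c) m) :
    ((∫ x, (t * x) ^ r * Real.exp (-(t * x)) ∂m : ℝ) : ℂ) = (1 / (2 * Real.pi) : ℝ) *
      ∫ y : ℝ, (t : ℂ) ^ (c + y * Complex.I) * Complex.Gamma (r - (c + y * Complex.I)) *
        mellinTransform m (c + y * Complex.I) := by
  have hpoint : ∀ᵐ x ∂m, (((t * x) ^ r * Real.exp (-(t * x)) : ℝ) : ℂ) =
      (1 / (2 * Real.pi) : ℝ) * ∫ y : ℝ, (t : ℂ) ^ (c + y * Complex.I) *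
        Complex.Gamma (r - (c + y * Complex.I)) * (x : ℂ) ^ (c + y * Complex.I) := by
    filter_upwards [hm] with x hx
    rw [pow_mul_exp_neg_eq_integral_Gamma hcr (mul_pos ht hx)]
    congr 2 with y
    rw [Complex.ofReal_mul, Complex.mul_cpow_ofReal_nonneg ht.le hx.le, mul_right_comm]
  rw [← integral_complex_ofReal, integral_congr_ae hpoint, integral_const_mul,
    integral_integral_swap (integrable_cpow_mul_Gamma_mul_cpow hm hcr ht hint)]
  simp only [mellinTransform, integral_const_mul]

end MellinParseval

section PowerMeasure

/-- The measure `x ^ (-α - 1) dx` on the unit interval, whose Mellin transform is `1 / (s - α)`.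
It is the model of a measure whose Mellin transform has a simple pole at `α`. -/
noncomputable def powerMeasure (α : ℝ) : Measure ℝ :=
  (volume.restrict (Set.Ioc 0 1)).withDensity fun x => ENNReal.ofReal (x ^ (-α - 1))

instance (α : ℝ) : SFinite (powerMeasure α) := by
  unfold powerMeasure; infer_instance

theorem ae_powerMeasure_pos (α : ℝ) : ∀ᵐ x ∂powerMeasure α, 0 < x :=
  (withDensity_absolutelyContinuous _ _).ae_le
    ((ae_restrict_mem measurableSet_Ioc).mono fun _ hx => hx.1)

theorem integral_powerMeasure {E : Type*} [NormedAddCommGroup E] [NormedSpace ℝ E] (α : ℝ)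
    (f : ℝ → E) : ∫ x, f x ∂powerMeasure α = ∫ x in Set.Ioc 0 1, x ^ (-α - 1) • f x := by
  rw [powerMeasure, integral_withDensity_eq_integral_toReal_smul (by fun_prop)
    (ae_of_all _ fun x => ENNReal.ofReal_lt_top)]
  refine setIntegral_congr_fun measurableSet_Ioc fun x hx => ?_
  simp only [ENNReal.toReal_ofReal (Real.rpow_nonneg hx.1.le _)]

theorem integrable_rpow_powerMeasure {α c : ℝ} (hc : α < c) :
    Integrable (fun x : ℝ => x ^ c) (powerMeasure α) := by
  rw [powerMeasure, integrable_withDensity_iff (by fun_prop)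
    (ae_of_all _ fun x => ENNReal.ofReal_lt_top)]
  have hpow : IntegrableOn (fun x : ℝ => x ^ (c - α - 1)) (Set.Ioc 0 1) :=
    (intervalIntegrable_iff_integrableOn_Ioc_of_le zero_le_one).mp
      (intervalIntegral.intervalIntegrable_rpow' (by linarith))
  refine hpow.congr_fun (fun x hx => ?_) measurableSet_Ioc
  simp only
  rw [ENNReal.toReal_ofReal (Real.rpow_nonneg hx.1.le _), ← Real.rpow_add hx.1]
  ring_nf

theorem mellinTransform_powerMeasure {α : ℝ} {s : ℂ} (hs : α < s.re) :
    mellinTransform (powerMeasure α) s = 1 / (s - α) := by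
  have hsα : s - α ≠ 0 := sub_ne_zero.mpr fun h => by simp [h] at hs
  have hpow : ∀ x ∈ Set.Ioc (0 : ℝ) 1,
      x ^ (-α - 1) • (x : ℂ) ^ s = (x : ℂ) ^ (s - α - 1) := fun x hx => by
    rw [Complex.real_smul, Complex.ofReal_cpow hx.1.le,
      ← Complex.cpow_add _ _ (by exact_mod_cast hx.1.ne')]
    congr 1
    push_cast
    ring
  rw [mellinTransform, integral_powerMeasure, setIntegral_congr_fun measurableSet_Ioc hpow,
    ← intervalIntegral.integral_of_le zero_le_one, integral_cpow (Or.inl (by simp; linarith))]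
  simp [hsα]

section ExponentialAverages

variable {a t : ℝ} {r : ℕ}

theorem integral_rpow_mul_pow_mul_exp_neg (ha : a < r) (ht : 0 < t) :
    ∫ x in Set.Ioi 0, x ^ (-a - 1) * ((t * x) ^ r * Real.exp (-(t * x))) =
      Real.Gamma (r - a) * t ^ a := by
  have hpow : ∀ x ∈ Set.Ioi (0 : ℝ), x ^ (-a - 1) * ((t * x) ^ r * Real.exp (-(t * x))) =
      t ^ r * (x ^ ((r : ℝ) - a - 1) * Real.exp (-(t * x))) := fun x hx => by
    rw [show (r : ℝ) - a - 1 = r + (-a - 1) by ring, Real.rpow_add hx, Real.rpow_natCast]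
    ring
  rw [setIntegral_congr_fun measurableSet_Ioi hpow, integral_const_mul,
    Real.integral_rpow_mul_exp_neg_mul_Ioi (sub_pos.mpr ha) ht, one_div,
    Real.inv_rpow ht.le, Real.rpow_sub ht, Real.rpow_natCast]
  field_simp

theorem integrableOn_rpow_mul_pow_mul_exp_neg (ha : a < r) (ht : 0 < t) :
    IntegrableOn (fun x : ℝ => x ^ (-a - 1) * ((t * x) ^ r * Real.exp (-(t * x)))) (Set.Ioi 0) :=
  Integrable.of_integral_ne_zero (by
    have := Real.Gamma_pos_of_pos (sub_pos.mpr ha)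
    rw [integral_rpow_mul_pow_mul_exp_neg ha ht]
    positivity)

theorem abs_integral_pow_mul_exp_powerMeasure_sub_le {b : ℝ} (ha : a < r) (hba : b ≤ a)
    (ht : 0 < t) :
    |∫ x, (t * x) ^ r * Real.exp (-(t * x)) ∂powerMeasure a - Real.Gamma (r - a) * t ^ a| ≤
      Real.Gamma (r - b) * t ^ b := by
  have hb : b < r := hba.trans_lt ha
  have hIoi : Set.Ioi (1 : ℝ) ⊆ Set.Ioi 0 := Set.Ioi_subset_Ioi zero_le_one
  have hpos : ∀ d : ℝ, ∀ x ∈ Set.Ioi (0 : ℝ),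
      0 ≤ x ^ (-d - 1) * ((t * x) ^ r * Real.exp (-(t * x))) := fun d x hx => by
    have hx0 : 0 < x := hx
    positivity
  have htail : ∫ x, (t * x) ^ r * Real.exp (-(t * x)) ∂powerMeasure a -
      Real.Gamma (r - a) * t ^ a =
        -∫ x in Set.Ioi 1, x ^ (-a - 1) * ((t * x) ^ r * Real.exp (-(t * x))) := by
    have hint := integrableOn_rpow_mul_pow_mul_exp_neg ha ht
    rw [← integral_rpow_mul_pow_mul_exp_neg ha ht, integral_powerMeasure,
      ← Set.Ioc_union_Ioi_eq_Ioi zero_le_one, setIntegral_union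
        (Set.Ioc_disjoint_Ioi le_rfl) measurableSet_Ioi
        (hint.mono_set Set.Ioc_subset_Ioi_self) (hint.mono_set hIoi)]
    simp only [smul_eq_mul]
    ring
  rw [htail, abs_neg, abs_of_nonneg (setIntegral_nonneg measurableSet_Ioi
    fun x hx => hpos a x (hIoi hx)), ← integral_rpow_mul_pow_mul_exp_neg hb ht]
  calc ∫ x in Set.Ioi 1, x ^ (-a - 1) * ((t * x) ^ r * Real.exp (-(t * x)))
      ≤ ∫ x in Set.Ioi 1, x ^ (-b - 1) * ((t * x) ^ r * Real.exp (-(t * x))) := by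
        refine setIntegral_mono_on ((integrableOn_rpow_mul_pow_mul_exp_neg ha ht).mono_set hIoi)
          ((integrableOn_rpow_mul_pow_mul_exp_neg hb ht).mono_set hIoi) measurableSet_Ioi
          fun x hx => ?_
        have hx0 : 0 < x := hIoi hx
        gcongr
        exact hx.le
    _ ≤ ∫ x in Set.Ioi 0, x ^ (-b - 1) * ((t * x) ^ r * Real.exp (-(t * x))) :=
        setIntegral_mono_set (integrableOn_rpow_mul_pow_mul_exp_neg hb ht)
          ((ae_restrict_mem measurableSet_Ioi).mono (hpos b)) hIoi.eventuallyLE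

end ExponentialAverages

end PowerMeasure

section SimplePole

/-- The Mellin transform of `m` converges on the line `Re s = c`, and there it is the sum of the
polar part `A / (s - α)` and a remainder which extends to a bounded holomorphic function on the
closed strip `β ≤ Re s ≤ c`. For `β < α < c` this is a simple pole at `α` with residue `A`. -/
structure HasSimpleMellinPole (m : Measure ℝ) (α β c : ℝ) (A : ℂ) : Prop where
  integrable : Integrable (fun x : ℝ => x ^ c) m
  exists_remainder : ∃ (G : ℂ → ℂ) (B : ℝ),
    (∀ s : ℂ, β ≤ s.re → s.re ≤ c → DifferentiableAt ℂ G s ∧ ‖G s‖ ≤ B) ∧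
    ∀ s : ℂ, s.re = c → mellinTransform m s = A / (s - α) + G s

theorem exists_norm_integral_cpow_mul_Gamma_mul_le {G : ℂ → ℂ} {B β c : ℝ} {r : ℕ} (hβc : β ≤ c)
    (hcr : c < r) (hG : ∀ s : ℂ, β ≤ s.re → s.re ≤ c → DifferentiableAt ℂ G s ∧ ‖G s‖ ≤ B) :
    ∃ D : ℝ, ∀ t : ℝ, 0 < t → ‖∫ y : ℝ, (t : ℂ) ^ (c + y * Complex.I) *
      Complex.Gamma (r - (c + y * Complex.I)) * G (c + y * Complex.I)‖ ≤ D * t ^ β := by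
  obtain ⟨C, hC⟩ := exists_norm_Gamma_le_div (sub_pos.mpr hcr) (r - β)
  have hbound : ∀ t : ℝ, 0 < t → ∀ s : ℂ, β ≤ s.re → s.re ≤ c →
      ‖(t : ℂ) ^ s * Complex.Gamma (r - s) * G s‖ ≤ t ^ s.re * (C * B / (1 + s.im ^ 2)) := by
    intro t ht s hs_ge hs_le
    have hΓ : ‖Complex.Gamma (r - s)‖ ≤ C / (1 + s.im ^ 2) := by
      simpa using hC (r - s) (by simp; linarith) (by simp; linarith)
    rw [norm_mul, norm_mul, Complex.norm_cpow_eq_rpow_re_of_pos ht, mul_assoc, mul_div_right_comm]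
    exact mul_le_mul_of_nonneg_left (mul_le_mul hΓ (hG s hs_ge hs_le).2 (norm_nonneg _)
      ((norm_nonneg _).trans hΓ)) (Real.rpow_nonneg ht.le _)
  have hCB : Integrable fun y : ℝ => C * B / (1 + y ^ 2) := by
    simpa only [div_eq_mul_inv] using integrable_inv_one_add_sq.const_mul (C * B)
  refine ⟨∫ y : ℝ, C * B / (1 + y ^ 2), fun t ht => ?_⟩
  have hshift := integral_vertical_eq (C := (t ^ c + t ^ β) * (C * B)) hβc
    (F := fun s => (t : ℂ) ^ s * Complex.Gamma (r - s) * G s)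
    (fun s hs_ge hs_le => ((differentiableAt_id.const_cpow
      (Or.inl (by exact_mod_cast ht.ne'))).mul ((differentiableAt_Gamma_of_re_pos
        (by simp; linarith)).comp s (by fun_prop))).mul (hG s hs_ge hs_le).1)
    fun s hs_ge hs_le => by
      have hnn : 0 ≤ C * B / (1 + s.im ^ 2) := by
        have := (norm_nonneg _).trans (hbound t ht s hs_ge hs_le)
        exact nonneg_of_mul_nonneg_right this (Real.rpow_pos_of_pos ht _)
      have hpow : t ^ s.re ≤ t ^ c + t ^ β := by
        rcases le_total 1 t with ht1 | ht1
        · linarith [Real.rpow_le_rpow_of_exponent_le ht1 hs_le, Real.rpow_nonneg ht.le β]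
        · linarith [Real.rpow_le_rpow_of_exponent_ge ht ht1 hs_ge, Real.rpow_nonneg ht.le c]
      exact ((hbound t ht s hs_ge hs_le).trans (mul_le_mul_of_nonneg_right hpow hnn)).trans_eq
        (mul_div_assoc _ _ _).symm
  rw [← hshift, ← integral_mul_const]
  refine norm_integral_le_of_norm_le (hCB.mul_const _) (ae_of_all _ fun y => ?_)
  simpa [mul_comm] using hbound t ht (β + y * Complex.I) (by simp) (by simpa using hβc)

theorem integral_pow_mul_exp_neg_eq_of_mellinTransform_eq {m : Measure ℝ} [SFinite m]
    {α c t : ℝ} {A : ℂ} {G : ℂ → ℂ} {r : ℕ} (hm : ∀ᵐ x ∂m, 0 < x) (hαc : α < c) (hcr : c < r)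
    (ht : 0 < t) (hint : Integrable (fun x : ℝ => x ^ c) m)
    (hG : ∀ s : ℂ, s.re = c → mellinTransform m s = A / (s - α) + G s) :
    ((∫ x, (t * x) ^ r * Real.exp (-(t * x)) ∂m : ℝ) : ℂ) =
      A * ((∫ x, (t * x) ^ r * Real.exp (-(t * x)) ∂powerMeasure α : ℝ) : ℂ) +
      (1 / (2 * Real.pi) : ℝ) * ∫ y : ℝ, (t : ℂ) ^ (c + y * Complex.I) *
        Complex.Gamma (r - (c + y * Complex.I)) * G (c + y * Complex.I) := by
  have hα := ae_powerMeasure_pos α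
  have hαint := integrable_rpow_powerMeasure hαc
  have hG_eq : ∀ y : ℝ, (t : ℂ) ^ (c + y * Complex.I) *
      Complex.Gamma (r - (c + y * Complex.I)) * G (c + y * Complex.I) =
      (t : ℂ) ^ (c + y * Complex.I) * Complex.Gamma (r - (c + y * Complex.I)) *
        mellinTransform m (c + y * Complex.I) -
      A * ((t : ℂ) ^ (c + y * Complex.I) * Complex.Gamma (r - (c + y * Complex.I)) *
        mellinTransform (powerMeasure α) (c + y * Complex.I)) := fun y => by
    rw [hG _ (by simp), mellinTransform_powerMeasure (by simpa using hαc)]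
    ring
  simp only [hG_eq]
  rw [integral_sub (integrable_cpow_mul_Gamma_mul_mellinTransform hm hcr ht hint)
      ((integrable_cpow_mul_Gamma_mul_mellinTransform hα hcr ht hαint).const_mul A),
    integral_const_mul, integral_pow_mul_exp_neg_eq_integral_mellinTransform hm hcr ht hint,
    integral_pow_mul_exp_neg_eq_integral_mellinTransform hα hcr ht hαint]
  ring

theorem HasSimpleMellinPole.isBigO_integral_pow_mul_exp_neg_sub {m : Measure ℝ} [SFinite m]
    {α β c : ℝ} {A : ℂ} {r : ℕ} (h : HasSimpleMellinPole m α β c A) (hm : ∀ᵐ x ∂m, 0 < x)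
    (hβα : β ≤ α) (hαc : α < c) (hcr : c < r) :
    (fun t : ℝ => ((∫ x, (t * x) ^ r * Real.exp (-(t * x)) ∂m : ℝ) : ℂ) -
      A * (Real.Gamma (r - α) * t ^ α : ℝ)) =O[atTop] fun t => t ^ β := by
  obtain ⟨G, B, hG, hmellin⟩ := h.exists_remainder
  obtain ⟨D, hD⟩ := exists_norm_integral_cpow_mul_Gamma_mul_le (hβα.trans hαc.le) hcr hG
  refine IsBigO.of_bound (‖A‖ * Real.Gamma (r - β) + 1 / (2 * Real.pi) * D) ?_
  filter_upwards [eventually_gt_atTop 0] with t ht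
  rw [integral_pow_mul_exp_neg_eq_of_mellinTransform_eq hm hαc hcr ht h.integrable hmellin,
    add_sub_right_comm, ← mul_sub, ← Complex.ofReal_sub,
    Real.norm_of_nonneg (Real.rpow_nonneg ht.le _), add_mul, mul_assoc, mul_assoc]
  refine norm_add_le_of_le ?_ ?_
  · rw [norm_mul, Complex.norm_real, Real.norm_eq_abs]
    gcongr
    exact abs_integral_pow_mul_exp_powerMeasure_sub_le (hαc.trans hcr) hβα ht
  · rw [norm_mul, Complex.norm_real, Real.norm_of_nonneg (by positivity)]
    gcongr
    exact hD t ht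

end SimplePole

theorem exists_eq_div_sub_add_of_simple_zero {f D : ℂ → ℂ} {U : Set ℂ} {a : ℂ} (hU : IsOpen U)
    (haU : a ∈ U) (hf : DifferentiableOn ℂ f U) (hD : DifferentiableOn ℂ D U)
    (hD0 : ∀ s ∈ U, D s = 0 ↔ s = a) (hD' : deriv D a ≠ 0) :
    ∃ G : ℂ → ℂ, DifferentiableOn ℂ G U ∧
      ∀ s ∈ U, s ≠ a → f s / D s = f a / deriv D a / (s - a) + G s := by
  have hDa : D a = 0 := (hD0 a haU).mpr rfl
  have hslope : ∀ s, s ≠ a → dslope D a s = D s / (s - a) := fun s hsa => by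
    rw [dslope_of_ne _ hsa, slope_def_field, hDa, sub_zero]
  have hslope0 : ∀ s ∈ U, dslope D a s ≠ 0 := fun s hs => by
    rcases eq_or_ne s a with rfl | hsa
    · rwa [dslope_same]
    · rw [hslope s hsa]
      exact div_ne_zero (mt (hD0 s hs).mp hsa) (sub_ne_zero.mpr hsa)
  have hquot : DifferentiableOn ℂ (fun s => f s / dslope D a s) U :=
    hf.div ((Complex.differentiableOn_dslope (hU.mem_nhds haU)).mpr hD) hslope0
  refine ⟨dslope (fun s => f s / dslope D a s) a,
    (Complex.differentiableOn_dslope (hU.mem_nhds haU)).mpr hquot, fun s hs hsa => ?_⟩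
  have hsa' : s - a ≠ 0 := sub_ne_zero.mpr hsa
  have hDs : D s ≠ 0 := mt (hD0 s hs).mp hsa
  rw [dslope_of_ne _ hsa, slope_def_field, dslope_same, hslope s hsa]
  field_simp
  ring

namespace Malthusian

variable {σ ν : Measure ℝ} {α ε δ : ℝ}

theorem integral_rpow_eq_one (hM : Malthusian σ ν α ε) (hσ : ∀ᵐ x ∂σ, 0 < x) :
    ∫ x, x ^ α ∂σ = 1 := by
  exact_mod_cast (mellinTransform_ofReal hσ α).symm.trans hM.psi_eq_one

theorem integral_rpow_lt_one (hM : Malthusian σ ν α ε) (hσ : ∀ᵐ x ∂σ, x ∈ Set.Ioc (0 : ℝ) 1)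
    {a : ℝ} (ha : α < a) : ∫ x, x ^ a ∂σ < 1 := by
  have hε := hM.eps_pos
  have hpos : ∀ᵐ x ∂σ, 0 < x := hσ.mono fun x hx => hx.1
  refine lt_of_le_of_ne ?_ fun h => ha.ne' ?_
  · rw [← hM.integral_rpow_eq_one hpos]
    exact integral_rpow_anti hσ ha.le (hM.psi_finite α (by linarith))
  · exact_mod_cast hM.unique a (by rw [Complex.ofReal_re]; linarith)
      (by rw [mellinTransform_ofReal hpos, h, Complex.ofReal_one])

theorem differentiableAt_psi (hM : Malthusian σ ν α ε) (hσ : ∀ᵐ x ∂σ, 0 < x)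
    {s : ℂ} (hs : α - ε < s.re) : DifferentiableAt ℂ (mellinTransform σ) s :=
  differentiableAt_mellinTransform hσ hM.psi_finite hs

theorem integrable_rpow_phi (hM : Malthusian σ ν α ε) (hν : ∀ᵐ x ∂ν, x ∈ Set.Ioc (0 : ℝ) 1)
    {a : ℝ} (ha : α - ε ≤ a) : Integrable (fun x : ℝ => x ^ a) ν :=
  integrable_rpow_of_le hν ha hM.phi_finite

theorem differentiableAt_phi (hM : Malthusian σ ν α ε) (hν : ∀ᵐ x ∂ν, x ∈ Set.Ioc (0 : ℝ) 1)
    {s : ℂ} (hs : α - ε < s.re) : DifferentiableAt ℂ (mellinTransform ν) s :=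
  differentiableAt_mellinTransform (hν.mono fun _ hx => hx.1)
    (fun _ hb => hM.integrable_rpow_phi hν hb.le) hs

theorem deriv_psi_ne_zero (hM : Malthusian σ ν α ε) (hσ : ∀ᵐ x ∂σ, x ∈ Set.Ioc (0 : ℝ) 1) :
    deriv (mellinTransform σ) α ≠ 0 := fun hderiv => by
  have hone : ∀ᵐ x ∂σ, x = 1 := ae_eq_one_of_deriv_mellinTransform_eq_zero hσ hM.psi_finite
    (sub_lt_self α hM.eps_pos) hderiv
  have hconst : ∫ x, x ^ (α + 1) ∂σ = ∫ x, x ^ α ∂σ := integral_congr_ae <| by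
    filter_upwards [hone] with x hx
    rw [hx, Real.one_rpow, Real.one_rpow]
  exact (hM.integral_rpow_lt_one hσ (lt_add_one α)).ne
    (hconst.trans (hM.integral_rpow_eq_one (hσ.mono fun x hx => hx.1)))

theorem one_sub_psi_eq_zero_iff (hM : Malthusian σ ν α ε) {s : ℂ} (hs : α - ε < s.re) :
    1 - mellinTransform σ s = 0 ↔ s = α :=
  ⟨fun h => hM.unique s hs (sub_eq_zero.mp h).symm,
    fun h => by rw [h, hM.psi_eq_one, sub_self]⟩

theorem norm_one_sub_psi_le (hM : Malthusian σ ν α ε) (hσ : ∀ᵐ x ∂σ, x ∈ Set.Ioc (0 : ℝ) 1)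
    (hδ : δ < ε) {s : ℂ} (hs : α - δ ≤ s.re) :
    ‖1 - mellinTransform σ s‖ ≤ 1 + ∫ x, x ^ (α - δ) ∂σ := by
  refine norm_sub_le_of_le norm_one.le ?_
  exact (norm_mellinTransform_le (hσ.mono fun x hx => hx.1) s).trans
    (integral_rpow_anti hσ hs (hM.psi_finite _ (by linarith)))

theorem one_sub_integral_le_norm_one_sub_psi (hσ : ∀ᵐ x ∂σ, 0 < x) (s : ℂ) :
    1 - ∫ x, x ^ s.re ∂σ ≤ ‖1 - mellinTransform σ s‖ := by
  have hsub := norm_sub_norm_le (1 : ℂ) (mellinTransform σ s)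
  rw [norm_one] at hsub
  linarith [norm_mellinTransform_le hσ s]

-- A disc centred on `Re s = α + 1`, where `|1 - ψ|` is bounded below, reaches the line
-- `Re s = α - δ`; if it is high enough it does not contain the only zero `α` of `1 - ψ`.
theorem exists_le_norm_one_sub_psi (hM : Malthusian σ ν α ε)
    (hσ : ∀ᵐ x ∂σ, x ∈ Set.Ioc (0 : ℝ) 1) (hδ0 : 0 < δ) (hδ : δ < ε) :
    ∃ κ T : ℝ, 0 < κ ∧ ∀ s : ℂ, α - δ ≤ s.re → s.re ≤ α + 1 → T ≤ |s.im| →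
      κ ≤ ‖1 - mellinTransform σ s‖ := by
  have hpos : ∀ᵐ x ∂σ, 0 < x := hσ.mono fun x hx => hx.1
  obtain ⟨δ', hδδ', hδ'⟩ := exists_between hδ
  have hgap : 0 < 1 - ∫ x, x ^ (α + 1) ∂σ :=
    sub_pos.mpr (hM.integral_rpow_lt_one hσ (lt_add_one α))
  refine ⟨_, 1 + δ', mul_pos hgap (Real.exp_pos _), fun s hs_ge hs_le hs_im =>
    le_norm_of_forall_mem_ball_ne_zero (f := fun s => 1 - mellinTransform σ s)
      (c := (α + 1 : ℝ) + s.im * Complex.I) (r := 1 + δ) (R := 1 + δ') hgap (by linarith)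
      (fun w hw => ?_) (fun w hw => ?_) (fun w hw => hM.norm_one_sub_psi_le hσ hδ' ?_) ?_ ?_⟩
  case refine_4 =>
    simpa using one_sub_integral_le_norm_one_sub_psi hpos ((α + 1 : ℝ) + s.im * Complex.I)
  case refine_5 =>
    have hsub : s - ((α + 1 : ℝ) + s.im * Complex.I) = ((s.re - (α + 1) : ℝ) : ℂ) := by
      apply Complex.ext <;> simp
    rw [Metric.mem_closedBall, dist_eq_norm, hsub, Complex.norm_real, Real.norm_eq_abs, abs_le]
    constructor <;> linarith
  all_goals
    rw [Metric.mem_ball, dist_eq_norm] at hw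
    have hre := (abs_lt.mp ((Complex.abs_re_le_norm _).trans_lt hw)).1
    have him := (Complex.abs_im_le_norm _).trans_lt hw
    simp only [Complex.sub_re, Complex.add_re, Complex.ofReal_re, Complex.re_ofReal_mul,
      Complex.I_re, mul_zero, add_zero, Complex.sub_im, Complex.add_im, Complex.ofReal_im,
      Complex.im_ofReal_mul, Complex.I_im, mul_one, zero_add] at hre him
  · exact ((differentiableAt_const _).sub
      (hM.differentiableAt_psi hpos (by linarith))).differentiableWithinAt
  · rw [Ne, hM.one_sub_psi_eq_zero_iff (by linarith)]
    rintro rfl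
    rw [Complex.ofReal_im, zero_sub, abs_neg] at him
    linarith
  · linarith

theorem exists_remainder (hM : Malthusian σ ν α ε) (hσ : ∀ᵐ x ∂σ, x ∈ Set.Ioc (0 : ℝ) 1)
    (hν : ∀ᵐ x ∂ν, x ∈ Set.Ioc (0 : ℝ) 1) :
    ∃ G : ℂ → ℂ, DifferentiableOn ℂ G {s | α - ε < s.re} ∧ ∀ s : ℂ, α - ε < s.re → s ≠ α →
      mellinTransform ν s / (1 - mellinTransform σ s) =
        -mellinTransform ν α / deriv (mellinTransform σ) α / (s - α) + G s := by
  have hderiv : deriv (fun s => 1 - mellinTransform σ s) α = -deriv (mellinTransform σ) α :=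
    deriv_const_sub _
  obtain ⟨G, hG, hG_eq⟩ := exists_eq_div_sub_add_of_simple_zero (a := α)
    (D := fun s => 1 - mellinTransform σ s)
    (isOpen_lt continuous_const Complex.continuous_re) (by simpa using hM.eps_pos)
    (fun s hs => (hM.differentiableAt_phi hν hs).differentiableWithinAt)
    (fun s hs => ((differentiableAt_const (1 : ℂ)).sub
      (hM.differentiableAt_psi (hσ.mono fun x hx => hx.1) hs)).differentiableWithinAt)
    (fun s hs => hM.one_sub_psi_eq_zero_iff hs)
    (hderiv.trans_ne (neg_ne_zero.mpr (hM.deriv_psi_ne_zero hσ)))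
  refine ⟨G, hG, fun s hs hsα => ?_⟩
  rw [neg_div, ← div_neg, ← hderiv]
  exact hG_eq s hs hsα

theorem exists_norm_quotient_le (hM : Malthusian σ ν α ε) (hσ : ∀ᵐ x ∂σ, x ∈ Set.Ioc (0 : ℝ) 1)
    (hν : ∀ᵐ x ∂ν, x ∈ Set.Ioc (0 : ℝ) 1) (hδ0 : 0 < δ) (hδ : δ < ε) :
    ∃ B T : ℝ, ∀ s : ℂ, α - δ ≤ s.re → s.re ≤ α + 1 → T ≤ |s.im| →
      ‖mellinTransform ν s / (1 - mellinTransform σ s)‖ ≤ B := by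
  obtain ⟨κ, T, hκ, hlow⟩ := hM.exists_le_norm_one_sub_psi hσ hδ0 hδ
  refine ⟨(∫ x, x ^ (α - δ) ∂ν) / κ, T, fun s hs_ge hs_le hs_im => ?_⟩
  have hφ : ‖mellinTransform ν s‖ ≤ ∫ x, x ^ (α - δ) ∂ν :=
    (norm_mellinTransform_le (hν.mono fun x hx => hx.1) s).trans
      (integral_rpow_anti hν hs_ge (hM.integrable_rpow_phi hν (by linarith)))
  rw [norm_div]
  exact div_le_div₀ ((norm_nonneg _).trans hφ) hφ hκ (hlow s hs_ge hs_le hs_im)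

theorem exists_norm_le_of_remainder (hM : Malthusian σ ν α ε)
    (hσ : ∀ᵐ x ∂σ, x ∈ Set.Ioc (0 : ℝ) 1) (hν : ∀ᵐ x ∂ν, x ∈ Set.Ioc (0 : ℝ) 1) (hδ0 : 0 < δ)
    (hδ : δ < ε) {A : ℂ} {G : ℂ → ℂ} (hG : ContinuousOn G {s | α - ε < s.re})
    (hG_eq : ∀ s : ℂ, α - ε < s.re → s ≠ α →
      mellinTransform ν s / (1 - mellinTransform σ s) = A / (s - α) + G s) :
    ∃ B : ℝ, ∀ s : ℂ, α - δ ≤ s.re → s.re ≤ α + 1 → ‖G s‖ ≤ B := by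
  obtain ⟨B₁, T, hfar⟩ := hM.exists_norm_quotient_le hσ hν hδ0 hδ
  obtain ⟨B₂, hnear⟩ :=
    ((isCompact_Icc (a := α - δ) (b := α + 1)).reProdIm
      (isCompact_Icc (a := -max T 1) (b := max T 1))).exists_bound_of_continuousOn
      (hG.mono fun s hs => (sub_lt_sub_left hδ α).trans_le hs.1.1)
  refine ⟨max B₂ (B₁ + ‖A‖), fun s hs_ge hs_le => ?_⟩
  rcases le_or_gt |s.im| (max T 1) with him | him
  · exact (hnear s ⟨⟨hs_ge, hs_le⟩, abs_le.mp him⟩).trans (le_max_left _ _)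
  have hone : 1 ≤ ‖s - α‖ := ((le_max_right T 1).trans him.le).trans
    (by simpa using Complex.abs_im_le_norm (s - α))
  have hsα : s ≠ α := sub_ne_zero.mp (norm_pos_iff.mp (one_pos.trans_le hone))
  rw [← add_sub_cancel_left (A / (s - α)) (G s), ← hG_eq s (by linarith) hsα]
  refine (norm_sub_le_of_le (hfar s hs_ge hs_le ((le_max_left T 1).trans him.le)) ?_).trans
    (le_max_right _ _)
  rw [norm_div]
  exact div_le_self (norm_nonneg A) hone

theorem hasSimpleMellinPole (hM : Malthusian σ ν α ε) (hσ : ∀ᵐ x ∂σ, x ∈ Set.Ioc (0 : ℝ) 1)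
    (hν : ∀ᵐ x ∂ν, x ∈ Set.Ioc (0 : ℝ) 1) (hδ0 : 0 < δ) (hδ : δ < ε) {m : Measure ℝ} {c : ℝ}
    (hαc : α < c) (hc : c ≤ α + 1) (hint : Integrable (fun x : ℝ => x ^ c) m)
    (hm : ∀ s : ℂ, s.re = c →
      mellinTransform m s = mellinTransform ν s / (1 - mellinTransform σ s)) :
    HasSimpleMellinPole m α (α - δ) c
      (-mellinTransform ν α / deriv (mellinTransform σ) α) := by
  obtain ⟨G, hG, hG_eq⟩ := hM.exists_remainder hσ hν
  obtain ⟨B, hB⟩ := hM.exists_norm_le_of_remainder hσ hν hδ0 hδ hG.continuousOn hG_eq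
  refine ⟨hint, G, B, fun s hs_ge hs_le => ⟨?_, hB s hs_ge (hs_le.trans hc)⟩, fun s hs => ?_⟩
  · exact hG.differentiableAt ((isOpen_lt continuous_const Complex.continuous_re).mem_nhds
      ((sub_lt_sub_left hδ α).trans_le hs_ge))
  · rw [hm s hs]
    refine hG_eq s (by linarith [hM.eps_pos]) ?_
    rintro rfl
    exact hαc.ne hs

end Malthusian

section PoissonApproximation

variable {n r : ℕ} {x : ℝ}

theorem pow_one_sub_le_exp_neg (hx1 : x ≤ 1) (n : ℕ) : (1 - x) ^ n ≤ Real.exp (-(n * x)) := by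
  rw [← mul_neg, Real.exp_nat_mul]
  exact pow_le_pow_left₀ (sub_nonneg.mpr hx1) (Real.one_sub_le_exp_neg x) n

theorem exp_neg_sub_pow_one_sub_le (hx0 : 0 ≤ x) (hx1 : x ≤ 1) (n : ℕ) :
    Real.exp (-(n * x)) - (1 - x) ^ n ≤ n * x ^ 2 * Real.exp (-(n * x)) := by
  have hbernoulli : 1 - n * x ^ 2 ≤ (1 - x ^ 2) ^ n := by
    simpa only [mul_neg, ← sub_eq_add_neg] using one_add_mul_le_pow (a := -x ^ 2) (by nlinarith) n
  have hexp : 1 - x ^ 2 ≤ (1 - x) * Real.exp x := by nlinarith [Real.add_one_le_exp x]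
  have hpow : (1 - x ^ 2) ^ n ≤ (1 - x) ^ n * Real.exp (n * x) := by
    rw [Real.exp_nat_mul, ← mul_pow]
    exact pow_le_pow_left₀ (by nlinarith) hexp n
  have hmul := mul_le_mul_of_nonneg_right (hbernoulli.trans hpow) (Real.exp_pos (-(n * x))).le
  rw [mul_assoc, ← Real.exp_add, add_neg_cancel, Real.exp_zero] at hmul
  linarith

theorem pow_sub_descFactorial_le (hrn : r ≤ n) :
    (n : ℝ) ^ r - n.descFactorial r ≤ r ^ 2 / n * (n : ℝ) ^ r := by
  rcases n.eq_zero_or_pos with rfl | hn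
  · simp [Nat.le_zero.mp hrn]
  have hn0 : (0 : ℝ) < n := by exact_mod_cast hn
  have hrn' : (r : ℝ) ≤ n := by exact_mod_cast hrn
  have hdesc : ((n : ℝ) - r) ^ r ≤ n.descFactorial r := by
    rw [← Nat.cast_sub hrn]
    exact_mod_cast (Nat.pow_le_pow_left (Nat.sub_le_sub_right n.le_succ r) r).trans
      (Nat.pow_sub_le_descFactorial n r)
  have hfactor : ((n : ℝ) - r) ^ r = (1 + -(r / n : ℝ)) ^ r * (n : ℝ) ^ r := by
    rw [← mul_pow, add_mul, neg_mul, div_mul_cancel₀ _ hn0.ne', one_mul, sub_eq_add_neg]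
  have hbernoulli := one_add_mul_le_pow (a := -(r / n : ℝ))
    (by linarith [(div_le_one hn0).mpr hrn']) r
  have hmul := mul_le_mul_of_nonneg_right hbernoulli (pow_pos hn0 r).le
  rw [← hfactor] at hmul
  linear_combination hmul + hdesc

theorem descFactorial_mul_sub_le (hn : n ≠ 0) (hrn : r ≤ n) (hx0 : 0 ≤ x) (hx1 : x ≤ 1) :
    n.descFactorial r * (x ^ r * (1 - x) ^ (n - r)) - (n * x) ^ r * Real.exp (-(n * x)) ≤
      r * Real.exp r / n * ((n * x) ^ (r + 1) * Real.exp (-(n * x))) := by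
  have hexp : Real.exp (r * x) - 1 ≤ r * x * Real.exp r := by
    have hone := Real.one_sub_le_exp_neg (r * x)
    have hinv : Real.exp (-(r * x)) * Real.exp (r * x) = 1 := by simp [← Real.exp_add]
    have hmono : Real.exp (r * x) ≤ Real.exp r :=
      Real.exp_le_exp.mpr (mul_le_of_le_one_right r.cast_nonneg hx1)
    nlinarith [Real.exp_pos (r * x), mul_nonneg (r.cast_nonneg : (0 : ℝ) ≤ r) hx0]
  have hbinom : n.descFactorial r * (x ^ r * (1 - x) ^ (n - r)) ≤
      (n * x) ^ r * Real.exp (-(n * x)) * Real.exp (r * x) := by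
    calc (n.descFactorial r : ℝ) * (x ^ r * (1 - x) ^ (n - r))
        ≤ n ^ r * (x ^ r * Real.exp (-((n - r : ℕ) * x))) := by
          gcongr
          · exact_mod_cast Nat.descFactorial_le_pow n r
          · exact pow_one_sub_le_exp_neg hx1 _
      _ = (n * x) ^ r * Real.exp (-(n * x)) * Real.exp (r * x) := by
          rw [mul_assoc, ← Real.exp_add, mul_pow, mul_assoc, Nat.cast_sub hrn]
          ring_nf
  calc _ ≤ (n * x) ^ r * Real.exp (-(n * x)) * (Real.exp (r * x) - 1) := by linarith
    _ ≤ (n * x) ^ r * Real.exp (-(n * x)) * (r * x * Real.exp r) := by gcongr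
    _ = _ := by
      have hn0 : (n : ℝ) ≠ 0 := by exact_mod_cast hn
      field_simp
      ring

theorem sub_descFactorial_mul_le (hn : n ≠ 0) (hrn : r ≤ n) (hx0 : 0 ≤ x) (hx1 : x ≤ 1) :
    (n * x) ^ r * Real.exp (-(n * x)) - n.descFactorial r * (x ^ r * (1 - x) ^ (n - r)) ≤
      r ^ 2 / n * ((n * x) ^ r * Real.exp (-(n * x))) +
        1 / n * ((n * x) ^ (r + 2) * Real.exp (-(n * x))) := by
  have hx1' : 0 ≤ 1 - x := sub_nonneg.mpr hx1
  have hpow : (1 - x) ^ n ≤ (1 - x) ^ (n - r) :=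
    pow_le_pow_of_le_one hx1' (sub_le_self 1 hx0) (n.sub_le r)
  calc (n * x) ^ r * Real.exp (-(n * x)) - n.descFactorial r * (x ^ r * (1 - x) ^ (n - r))
      ≤ (n * x) ^ r * Real.exp (-(n * x)) - n.descFactorial r * (x ^ r * (1 - x) ^ n) := by
        gcongr
    _ = x ^ r * (((n : ℝ) ^ r - n.descFactorial r) * (1 - x) ^ n +
          n ^ r * (Real.exp (-(n * x)) - (1 - x) ^ n)) := by ring
    _ ≤ x ^ r * (r ^ 2 / n * (n : ℝ) ^ r * Real.exp (-(n * x)) +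
          n ^ r * (n * x ^ 2 * Real.exp (-(n * x)))) := by
        gcongr
        · exact pow_sub_descFactorial_le hrn
        · exact pow_one_sub_le_exp_neg hx1 n
        · exact exp_neg_sub_pow_one_sub_le hx0 hx1 n
    _ = _ := by
        have hn0 : (n : ℝ) ≠ 0 := by exact_mod_cast hn
        field_simp
        ring

theorem abs_descFactorial_mul_sub_le (hn : n ≠ 0) (hrn : r ≤ n) (hx0 : 0 ≤ x) (hx1 : x ≤ 1) :
    |n.descFactorial r * (x ^ r * (1 - x) ^ (n - r)) - (n * x) ^ r * Real.exp (-(n * x))| ≤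
      (r ^ 2 + r * Real.exp r + 1) / n *
        ∑ k ∈ Finset.range 3, (n * x) ^ (r + k) * Real.exp (-(n * x)) := by
  have hnn : ∀ {a : ℝ}, 0 ≤ a → ∀ k : ℕ,
      0 ≤ a / n * ((n * x) ^ k * Real.exp (-(n * x))) := fun ha k => by positivity
  have hr2 := hnn (sq_nonneg (r : ℝ))
  have hexp := hnn (mul_nonneg r.cast_nonneg (Real.exp_pos r).le)
  have hone := hnn zero_le_one
  simp only [Finset.sum_range_succ, Finset.sum_range_zero, zero_add, add_zero, add_div, add_mul,
    mul_add]
  refine abs_sub_le_iff.mpr ⟨(descFactorial_mul_sub_le hn hrn hx0 hx1).trans ?_,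
    (sub_descFactorial_mul_le hn hrn hx0 hx1).trans ?_⟩ <;>
  linarith [hr2 r, hr2 (r + 1), hr2 (r + 2), hexp r, hexp (r + 1), hexp (r + 2), hone r,
    hone (r + 1), hone (r + 2)]

end PoissonApproximation

section PowerSums

theorem rpow_sub_rpow_le {a b p : ℝ} (ha : 0 < a) (hb : 0 ≤ b) (hp0 : 0 ≤ p) (hp1 : p ≤ 1) :
    b ^ p - a ^ p ≤ p * a ^ (p - 1) * (b - a) := by
  have hbernoulli := rpow_one_add_le_one_add_mul_self (s := b / a - 1)
    (by linarith [div_nonneg hb ha.le]) hp0 hp1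
  rw [add_sub_cancel, Real.div_rpow hb ha.le, div_le_iff₀ (Real.rpow_pos_of_pos ha p)]
    at hbernoulli
  rw [sub_le_iff_le_add]
  refine hbernoulli.trans_eq ?_
  rw [Real.rpow_sub_one ha.ne']
  field_simp
  ring

theorem mul_sum_rpow_sub_one_le {p : ℝ} (hp0 : 0 < p) (hp1 : p ≤ 1) (n : ℕ) :
    p * ∑ m ∈ Finset.range n, ((m : ℝ) + 1) ^ (p - 1) ≤ (n : ℝ) ^ p := by
  have htel := Finset.sum_range_sub (fun m : ℕ => (m : ℝ) ^ p) n
  rw [Nat.cast_zero, Real.zero_rpow hp0.ne', sub_zero] at htel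
  rw [← htel, Finset.mul_sum]
  refine Finset.sum_le_sum fun m _ => ?_
  have h := rpow_sub_rpow_le (a := (m : ℝ) + 1) (b := m) (by positivity) m.cast_nonneg hp0.le hp1
  push_cast
  linarith

theorem rpow_sub_one_le_mul_sum_rpow_sub_one {p : ℝ} (hp0 : 0 ≤ p) (hp1 : p ≤ 1) (n : ℕ) :
    ((n : ℝ) + 1) ^ p - 1 ≤ p * ∑ m ∈ Finset.range n, ((m : ℝ) + 1) ^ (p - 1) := by
  have htel := Finset.sum_range_sub (fun m : ℕ => ((m : ℝ) + 1) ^ p) n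
  rw [Nat.cast_zero, zero_add, Real.one_rpow] at htel
  rw [← htel, Finset.mul_sum]
  refine Finset.sum_le_sum fun m _ => ?_
  have h := rpow_sub_rpow_le (a := (m : ℝ) + 1) (b := (m : ℝ) + 1 + 1) (by positivity)
    (by positivity) hp0 hp1
  push_cast
  linarith

theorem isBigO_sum_rpow_sub_one_sub {p : ℝ} (hp0 : 0 < p) (hp1 : p ≤ 1) :
    (fun n : ℕ => ∑ m ∈ Finset.range n, ((m : ℝ) + 1) ^ (p - 1) - (n : ℝ) ^ p / p)
      =O[atTop] fun _ => (1 : ℝ) := by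
  refine IsBigO.of_bound (1 / p) (Eventually.of_forall fun n => ?_)
  have hle : (n : ℝ) ^ p ≤ ((n : ℝ) + 1) ^ p := by gcongr; linarith
  have hlow := rpow_sub_one_le_mul_sum_rpow_sub_one hp0.le hp1 n
  have hup := mul_sum_rpow_sub_one_le hp0 hp1 n
  rw [norm_one, mul_one, Real.norm_eq_abs, le_div_iff₀ hp0, ← abs_of_pos hp0, ← abs_mul,
    sub_mul, abs_of_pos hp0, div_mul_cancel₀ _ hp0.ne', abs_le]
  constructor <;> linarith

theorem isBigO_sum_rpow_sub_one {p : ℝ} (hp : p ≠ 0) (hp1 : p ≤ 1) :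
    (fun n : ℕ => ∑ m ∈ Finset.range n, ((m : ℝ) + 1) ^ (p - 1))
      =O[atTop] fun n : ℕ => (n : ℝ) ^ max p 0 := by
  rcases hp.lt_or_gt with hneg | hpos
  · have hsummable : Summable fun m : ℕ => ((m : ℝ) + 1) ^ (p - 1) := by
      simpa only [Nat.cast_add_one] using
        (summable_nat_add_iff 1).mpr (Real.summable_nat_rpow.mpr (by linarith))
    simpa only [max_eq_right hneg.le, Real.rpow_zero] using
      hsummable.hasSum.tendsto_sum_nat.isBigO_one ℝ
  · refine IsBigO.of_bound (1 / p) (Eventually.of_forall fun n => ?_)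
    rw [max_eq_left hpos.le, Real.norm_of_nonneg (by positivity),
      Real.norm_of_nonneg (by positivity), one_div, ← div_eq_inv_mul, le_div_iff₀' hpos]
    exact mul_sum_rpow_sub_one_le hpos hp1 n

theorem isBigO_sum_range {E : Type*} [SeminormedAddCommGroup E] {f : ℕ → E} {g : ℕ → ℝ}
    (hg : ∀ n, 0 < g n) (h : f =O[atTop] g) :
    (fun n => ∑ m ∈ Finset.range n, f m) =O[atTop] fun n => ∑ m ∈ Finset.range n, g m := by
  obtain ⟨B, -, hB⟩ := bound_of_isBigO_nat_atTop h
  refine IsBigO.of_bound B (Eventually.of_forall fun n => ?_)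
  rw [Real.norm_of_nonneg (Finset.sum_nonneg fun m _ => (hg m).le), Finset.mul_sum]
  refine norm_sum_le_of_le _ fun m _ => (hB (hg m).ne').trans_eq ?_
  rw [Real.norm_of_nonneg (hg m).le]

end PowerSums

section BinomialAsymptotics

theorem isBigO_rpow_rpow_atTop {p q : ℝ} (hpq : p ≤ q) :
    (fun t : ℝ => t ^ p) =O[atTop] fun t => t ^ q := by
  refine IsBigO.of_norm_eventuallyLE ?_
  filter_upwards [eventually_ge_atTop 1] with t ht
  rw [Real.norm_of_nonneg (Real.rpow_nonneg (zero_le_one.trans ht) p)]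
  exact Real.rpow_le_rpow_of_exponent_le ht hpq

variable {m : Measure ℝ} {α β c : ℝ} {A : ℂ} {r : ℕ}

theorem integrable_pow_mul (hm : ∀ᵐ x ∂m, x ∈ Set.Ioc (0 : ℝ) 1) (hcr : c ≤ r)
    (hint : Integrable (fun x : ℝ => x ^ c) m) {f : ℝ → ℝ} (hf : Measurable f)
    (hf1 : ∀ x ∈ Set.Ioc (0 : ℝ) 1, f x ∈ Set.Icc (0 : ℝ) 1) :
    Integrable (fun x => x ^ r * f x) m := by
  have hpow : Integrable (fun x : ℝ => x ^ r) m := by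
    simpa only [Real.rpow_natCast] using integrable_rpow_of_le hm hcr hint
  refine hpow.mul_bdd (c := 1) hf.aestronglyMeasurable ?_
  filter_upwards [hm] with x hx
  rw [Real.norm_of_nonneg (hf1 x hx).1]
  exact (hf1 x hx).2

theorem integrable_pow_mul_one_sub_pow (hm : ∀ᵐ x ∂m, x ∈ Set.Ioc (0 : ℝ) 1) (hcr : c ≤ r)
    (hint : Integrable (fun x : ℝ => x ^ c) m) (k : ℕ) :
    Integrable (fun x : ℝ => x ^ r * (1 - x) ^ k) m :=
  integrable_pow_mul hm hcr hint (by fun_prop) fun _ hx =>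
    ⟨pow_nonneg (sub_nonneg.mpr hx.2) k,
      pow_le_one₀ (sub_nonneg.mpr hx.2) (sub_le_self 1 hx.1.le)⟩

theorem integrable_pow_mul_exp_neg (hm : ∀ᵐ x ∂m, x ∈ Set.Ioc (0 : ℝ) 1) (hcr : c ≤ r)
    (hint : Integrable (fun x : ℝ => x ^ c) m) {t : ℝ} (ht : 0 ≤ t) :
    Integrable (fun x : ℝ => (t * x) ^ r * Real.exp (-(t * x))) m := by
  simp only [mul_pow, mul_assoc]
  exact (integrable_pow_mul hm hcr hint (by fun_prop) fun x hx =>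
    ⟨(Real.exp_pos _).le, Real.exp_le_one_iff.mpr (neg_nonpos.mpr
      (mul_nonneg ht hx.1.le))⟩).const_mul (t ^ r)

theorem abs_descFactorial_mul_integral_sub_le (hm : ∀ᵐ x ∂m, x ∈ Set.Ioc (0 : ℝ) 1)
    (hcr : c ≤ r) (hint : Integrable (fun x : ℝ => x ^ c) m) {n : ℕ} (hn : n ≠ 0) (hrn : r ≤ n) :
    |n.descFactorial r * ∫ x, x ^ r * (1 - x) ^ (n - r) ∂m -
        ∫ x, (n * x) ^ r * Real.exp (-(n * x)) ∂m| ≤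
      (r ^ 2 + r * Real.exp r + 1) / n *
        ∑ k ∈ Finset.range 3, ∫ x, (n * x) ^ (r + k) * Real.exp (-(n * x)) ∂m := by
  have hexp : ∀ k : ℕ, Integrable (fun x : ℝ => (n * x) ^ (r + k) * Real.exp (-(n * x))) m :=
    fun k => integrable_pow_mul_exp_neg hm (hcr.trans (by simp)) hint n.cast_nonneg
  rw [← integral_const_mul, ← integral_finsetSum _ fun k _ => hexp k, ← integral_const_mul,
    ← integral_sub ((integrable_pow_mul_one_sub_pow hm hcr hint _).const_mul _)
      (integrable_pow_mul_exp_neg hm hcr hint n.cast_nonneg),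
    ← Real.norm_eq_abs]
  refine norm_integral_le_of_norm_le
    ((integrable_finsetSum _ fun k _ => hexp k).const_mul _) ?_
  filter_upwards [hm] with x hx
  exact abs_descFactorial_mul_sub_le hn hrn hx.1.le hx.2

namespace HasSimpleMellinPole

variable [SFinite m]

theorem isBigO_integral_pow_mul_exp_neg (h : HasSimpleMellinPole m α β c A)
    (hm : ∀ᵐ x ∂m, 0 < x) (hβα : β ≤ α) (hαc : α < c) (hcr : c < r) :
    (fun t : ℝ => ∫ x, (t * x) ^ r * Real.exp (-(t * x)) ∂m) =O[atTop] fun t => t ^ α := by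
  have hmain : (fun t : ℝ => A * (Real.Gamma (r - α) * t ^ α : ℝ)) =O[atTop] fun t => t ^ α :=
    IsBigO.of_bound (‖A‖ * ‖Real.Gamma (r - α)‖) (Eventually.of_forall fun t => by
      rw [norm_mul, Complex.norm_real, norm_mul, mul_assoc])
  have hβ : (fun t : ℝ => t ^ β) =O[atTop] fun t => t ^ α := isBigO_rpow_rpow_atTop hβα
  refine IsBigO.of_norm_left ?_
  simpa only [sub_add_cancel, Complex.norm_real] using
    (((h.isBigO_integral_pow_mul_exp_neg_sub hm hβα hαc hcr).trans hβ).add hmain).norm_left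

theorem isBigO_descFactorial_mul_integral_sub (h : HasSimpleMellinPole m α β c A)
    (hm : ∀ᵐ x ∂m, x ∈ Set.Ioc (0 : ℝ) 1) (hβα : β ≤ α) (hαβ : α - 1 ≤ β) (hαc : α < c)
    (hcr : c < r) :
    (fun n : ℕ => ((n.descFactorial r * ∫ x, x ^ r * (1 - x) ^ (n - r) ∂m : ℝ) : ℂ) -
      A * (Real.Gamma (r - α) * (n : ℝ) ^ α : ℝ)) =O[atTop] fun n : ℕ => (n : ℝ) ^ β := by
  have hpos : ∀ᵐ x ∂m, 0 < x := hm.mono fun x hx => hx.1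
  have hsum : (fun n : ℕ => ∑ k ∈ Finset.range 3,
      ∫ x, (n * x) ^ (r + k) * Real.exp (-(n * x)) ∂m) =O[atTop] fun n : ℕ => (n : ℝ) ^ α := by
    refine IsBigO.fun_sum fun k _ => ?_
    have hcrk : c < (r + k : ℕ) := hcr.trans_le (by simp)
    exact (h.isBigO_integral_pow_mul_exp_neg hpos hβα hαc hcrk).natCast_atTop
  have hpoisson : (fun n : ℕ => n.descFactorial r * ∫ x, x ^ r * (1 - x) ^ (n - r) ∂m -
      ∫ x, (n * x) ^ r * Real.exp (-(n * x)) ∂m) =O[atTop] fun n : ℕ => (n : ℝ) ^ (α - 1) := by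
    obtain ⟨B, hB⟩ := hsum.bound
    refine IsBigO.of_bound ((r ^ 2 + r * Real.exp r + 1) * B) ?_
    filter_upwards [hB, eventually_ge_atTop r, eventually_ne_atTop 0] with n hnB hrn hn
    refine (abs_descFactorial_mul_integral_sub_le hm hcr.le h.integrable hn hrn).trans ?_
    have hn0 : (n : ℝ) ≠ 0 := by exact_mod_cast hn
    rw [Real.rpow_sub_one hn0, norm_div, Real.norm_natCast]
    calc _ ≤ (r ^ 2 + r * Real.exp r + 1) / n * (B * ‖(n : ℝ) ^ α‖) := by
          gcongr
          exact (le_abs_self _).trans hnB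
      _ = _ := by ring
  have hβ : (fun n : ℕ => (n : ℝ) ^ (α - 1)) =O[atTop] fun n : ℕ => (n : ℝ) ^ β :=
    (isBigO_rpow_rpow_atTop hαβ).natCast_atTop
  refine ((Complex.isBigO_ofReal_left.mpr (hpoisson.trans hβ)).add
    (h.isBigO_integral_pow_mul_exp_neg_sub hpos hβα hαc hcr).natCast_atTop).congr_left fun n => ?_
  rw [Complex.ofReal_sub, sub_add_sub_cancel]

theorem isBigO_integral_mul_one_sub_pow_sub (h : HasSimpleMellinPole m α β c A)
    (hm : ∀ᵐ x ∂m, x ∈ Set.Ioc (0 : ℝ) 1) (hβα : β ≤ α) (hαβ : α - 1 ≤ β) (hαc : α < c)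
    (hc1 : c < 1) :
    (fun k : ℕ => ((∫ x, x * (1 - x) ^ k ∂m : ℝ) : ℂ) -
      A * (Real.Gamma (1 - α) * ((k : ℝ) + 1) ^ (α - 1) : ℝ))
        =O[atTop] fun k : ℕ => ((k : ℝ) + 1) ^ (β - 1) := by
  have hshift := (h.isBigO_descFactorial_mul_integral_sub (r := 1) hm hβα hαβ hαc
    (by exact_mod_cast hc1)).comp_tendsto (tendsto_add_atTop_nat 1)
  have hdiv := (isBigO_refl (fun k : ℕ => ((k : ℝ) + 1)⁻¹) atTop).smul hshift
  refine hdiv.congr (fun k => ?_) fun k => ?_ <;>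
    have hk : (k : ℝ) + 1 ≠ 0 := by positivity
  · have hk' : (k : ℂ) + 1 ≠ 0 := by exact_mod_cast hk
    simp only [Function.comp_apply, Nat.descFactorial_one, pow_one, Nat.add_sub_cancel,
      Nat.cast_add, Nat.cast_one, Complex.real_smul, Real.rpow_sub_one hk]
    push_cast
    field_simp
  · simp only [Function.comp_apply, Nat.cast_add_one, smul_eq_mul, Real.rpow_sub_one hk]
    ring

theorem isBigO_sum_integral_mul_one_sub_pow_sub (h : HasSimpleMellinPole m α β c A)
    (hm : ∀ᵐ x ∂m, x ∈ Set.Ioc (0 : ℝ) 1) (hα0 : 0 < α) (hβα : β ≤ α) (hαβ : α - 1 ≤ β)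
    (hαc : α < c) (hc1 : c < 1) (hβ0 : β ≠ 0) :
    (fun n : ℕ => ((∑ k ∈ Finset.range n, ∫ x, x * (1 - x) ^ k ∂m : ℝ) : ℂ) -
      A * (Real.Gamma (1 - α) * ((n : ℝ) ^ α / α) : ℝ))
        =O[atTop] fun n : ℕ => (n : ℝ) ^ max β 0 := by
  have hα1 : α ≤ 1 := (hαc.trans hc1).le
  have hterms := (isBigO_sum_range (fun k => by positivity)
    (h.isBigO_integral_mul_one_sub_pow_sub hm hβα hαβ hαc hc1)).trans
    (isBigO_sum_rpow_sub_one hβ0 (hβα.trans hα1))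
  have hone : (fun _ : ℕ => (1 : ℝ)) =O[atTop] fun n : ℕ => (n : ℝ) ^ max β 0 := by
    simpa only [Function.comp_def, Real.rpow_zero] using
      (isBigO_rpow_rpow_atTop (le_max_right β 0)).natCast_atTop
  have hmain := (Complex.isBigO_ofReal_left.mpr
    ((isBigO_sum_rpow_sub_one_sub hα0 hα1).trans hone)).const_mul_left
      (A * (Real.Gamma (1 - α) : ℝ))
  refine (hterms.add hmain).congr_left fun n => ?_
  rw [Finset.sum_sub_distrib, ← Finset.mul_sum]
  simp only [← Complex.ofReal_sum, ← Finset.mul_sum]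
  push_cast
  ring

end HasSimpleMellinPole

end BinomialAsymptotics

section MultiplicativeConvolution

variable {M N : Measure ℝ}

theorem integrable_cpow (hM : ∀ᵐ x ∂M, 0 < x) {s : ℂ}
    (hint : Integrable (fun x : ℝ => x ^ s.re) M) : Integrable (fun x : ℝ => (x : ℂ) ^ s) M := by
  refine (integrable_norm_iff
    (Complex.measurable_ofReal.pow_const s).aestronglyMeasurable).mp (hint.congr ?_)
  filter_upwards [hM] with x hx using (Complex.norm_cpow_eq_rpow_re_of_pos hx s).symm

theorem integrable_rpow_iff_lintegral_ne_top (hM : ∀ᵐ x ∂M, 0 < x) {a : ℝ} :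
    Integrable (fun x : ℝ => x ^ a) M ↔ ∫⁻ x, ENNReal.ofReal x ^ a ∂M ≠ ∞ := by
  have hnonneg : 0 ≤ᵐ[M] fun x : ℝ => x ^ a := hM.mono fun x hx => Real.rpow_nonneg hx.le _
  rw [← lintegral_ofReal_ne_top_iff_integrable (by fun_prop) hnonneg,
    lintegral_congr_ae (hM.mono fun x hx => (ENNReal.ofReal_rpow_of_pos hx).symm)]

theorem ofReal_integral_rpow (hM : ∀ᵐ x ∂M, 0 < x) {a : ℝ}
    (hint : Integrable (fun x : ℝ => x ^ a) M) :
    ENNReal.ofReal (∫ x, x ^ a ∂M) = ∫⁻ x, ENNReal.ofReal x ^ a ∂M := by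
  have hnonneg : 0 ≤ᵐ[M] fun x : ℝ => x ^ a := hM.mono fun x hx => Real.rpow_nonneg hx.le _
  rw [ofReal_integral_eq_lintegral_ofReal hint hnonneg,
    lintegral_congr_ae (hM.mono fun x hx => (ENNReal.ofReal_rpow_of_pos hx).symm)]

theorem lintegral_rpow_mconv [SFinite N] (hM : ∀ᵐ x ∂M, 0 ≤ x) {a : ℝ} (ha : 0 ≤ a) :
    ∫⁻ x, ENNReal.ofReal x ^ a ∂(M ∗ₘ N) =
      (∫⁻ x, ENNReal.ofReal x ^ a ∂M) * ∫⁻ x, ENNReal.ofReal x ^ a ∂N := by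
  rw [Measure.lintegral_mconv (by fun_prop), ← lintegral_mul_const _ (by fun_prop)]
  refine lintegral_congr_ae ?_
  filter_upwards [hM] with x hx
  rw [← lintegral_const_mul _ (by fun_prop)]
  refine lintegral_congr fun y => ?_
  rw [ENNReal.ofReal_mul hx, ENNReal.mul_rpow_of_nonneg _ _ ha]

theorem ae_prod_pos (hM : ∀ᵐ x ∂M, 0 < x) (hN : ∀ᵐ x ∂N, 0 < x) :
    ∀ᵐ p ∂M.prod N, 0 < p.1 ∧ 0 < p.2 :=
  (Measure.quasiMeasurePreserving_fst.ae hM).and (Measure.quasiMeasurePreserving_snd.ae hN)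

theorem integrable_rpow_mconv (hM : ∀ᵐ x ∂M, 0 < x)
    (hN : ∀ᵐ x ∂N, 0 < x) {a : ℝ} (hMa : Integrable (fun x : ℝ => x ^ a) M)
    (hNa : Integrable (fun x : ℝ => x ^ a) N) : Integrable (fun x : ℝ => x ^ a) (M ∗ₘ N) := by
  refine (integrable_map_measure (by fun_prop) (by fun_prop)).mpr ((hMa.mul_prod hNa).congr ?_)
  filter_upwards [ae_prod_pos hM hN] with p hp
  exact (Real.mul_rpow hp.1.le hp.2.le).symm

theorem mellinTransform_mconv [SFinite M] [SFinite N] (hM : ∀ᵐ x ∂M, 0 < x)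
    (hN : ∀ᵐ x ∂N, 0 < x) (s : ℂ) :
    mellinTransform (M ∗ₘ N) s = mellinTransform M s * mellinTransform N s := by
  rw [mellinTransform, Measure.mconv, integral_map (by fun_prop)
    (Complex.measurable_ofReal.pow_const s).aestronglyMeasurable, mellinTransform, mellinTransform,
    ← integral_prod_mul]
  refine integral_congr_ae ?_
  filter_upwards [ae_prod_pos hM hN] with p hp
  rw [Complex.ofReal_mul, Complex.mul_cpow_ofReal_nonneg hp.1.le hp.2.le]

theorem restrict_Ioi_mconv [SFinite M] [SFinite N] (hM : ∀ᵐ x ∂M, 0 ≤ x) :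
    (M ∗ₘ N).restrict (Set.Ioi 0) = M.restrict (Set.Ioi 0) ∗ₘ N.restrict (Set.Ioi 0) := by
  rw [Measure.mconv, Measure.mconv, Measure.restrict_map (by fun_prop) measurableSet_Ioi,
    Measure.prod_restrict]
  congr 1
  refine Measure.restrict_congr_set ?_
  filter_upwards [Measure.quasiMeasurePreserving_fst.ae hM] with p hp
  refine propext ⟨fun (h : 0 < p.1 * p.2) => ?_, fun h => Set.mem_Ioi.mpr (mul_pos h.1 h.2)⟩
  exact ⟨hp.lt_of_ne' (left_ne_zero_of_mul h.ne'), pos_of_mul_pos_right h hp⟩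

end MultiplicativeConvolution

section FamilyIntensity

variable {Ω ι : Type*} [MeasurableSpace Ω] {μ : Measure Ω} {Z : ι → Ω → ℝ}

/-- The intensity measure of the point process of the positive terms of a family of random
variables. Crumbs and solids are not indexed by `ℕ`, the only index type of `intensity`. -/
noncomputable def familyIntensity (μ : Measure Ω) (Z : ι → Ω → ℝ) : Measure ℝ :=
  (Measure.sum fun i => μ.map (Z i)).restrict (Set.Ioi 0)

theorem intensity_eq_familyIntensity (μ : Measure Ω) (Z : ℕ → Ω → ℝ) :
    intensity μ Z = familyIntensity μ Z :=
  rfl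

instance [Countable ι] [SFinite μ] : SFinite (familyIntensity μ Z) := by
  unfold familyIntensity; infer_instance

theorem ae_familyIntensity_pos (μ : Measure Ω) (Z : ι → Ω → ℝ) :
    ∀ᵐ x ∂familyIntensity μ Z, 0 < x :=
  ae_restrict_mem measurableSet_Ioi

theorem ae_familyIntensity_mem_Ioc [Countable ι] (hZ : ∀ i, Measurable (Z i))
    (hZ1 : ∀ i, ∀ᵐ ω ∂μ, Z i ω ∈ Set.Icc (0 : ℝ) 1) :
    ∀ᵐ x ∂familyIntensity μ Z, x ∈ Set.Ioc (0 : ℝ) 1 := by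
  have hle : ∀ᵐ x ∂(Measure.sum fun i => μ.map (Z i)), x ≤ 1 :=
    Measure.ae_sum_iff.mpr fun i => (ae_map_iff (hZ i).aemeasurable measurableSet_Iic).mpr
      ((hZ1 i).mono fun ω h => h.2)
  filter_upwards [ae_familyIntensity_pos μ Z, ae_restrict_of_ae hle] with x hx0 hx1
  exact ⟨hx0, hx1⟩

theorem lintegral_familyIntensity (hZ : ∀ i, Measurable (Z i)) {f : ℝ → ℝ≥0∞}
    (hf : Measurable f) (hf0 : ∀ x ≤ 0, f x = 0) :
    ∫⁻ x, f x ∂familyIntensity μ Z = ∑' i, ∫⁻ ω, f (Z i ω) ∂μ := by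
  have hsupport : f.support ⊆ Set.Ioi 0 := fun x hx => not_le.mp fun h => hx (hf0 x h)
  rw [familyIntensity, setLIntegral_eq_of_support_subset hsupport, lintegral_sum_measure]
  exact tsum_congr fun i => lintegral_map hf (hZ i)

theorem lintegral_rpow_familyIntensity {a : ℝ} (hZ : ∀ i, Measurable (Z i)) (ha : 0 < a) :
    ∫⁻ x, ENNReal.ofReal x ^ a ∂familyIntensity μ Z =
      ∑' i, ∫⁻ ω, ENNReal.ofReal (Z i ω) ^ a ∂μ :=
  lintegral_familyIntensity hZ (by fun_prop) fun x hx => by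
    rw [ENNReal.ofReal_of_nonpos hx, ENNReal.zero_rpow_of_pos ha]

theorem familyIntensity_eq_mconv {Ω' κ : Type*} [MeasurableSpace Ω'] {μ' : Measure Ω'}
    [SFinite μ] [SFinite μ'] [Countable ι] [Countable κ] {V : κ → Ω' → ℝ} {W : ι × κ → Ω → ℝ}
    (hZ : ∀ i, Measurable (Z i)) (hZ0 : ∀ i, ∀ᵐ ω ∂μ, 0 ≤ Z i ω)
    (hW : ∀ i j, μ.map (W (i, j)) = μ.map (Z i) ∗ₘ μ'.map (V j)) :
    familyIntensity μ W = familyIntensity μ Z ∗ₘ familyIntensity μ' V := by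
  have hnonneg : ∀ᵐ x ∂(Measure.sum fun i => μ.map (Z i)), 0 ≤ x :=
    Measure.ae_sum_iff.mpr fun i =>
      (ae_map_iff (hZ i).aemeasurable measurableSet_Ici).mpr (hZ0 i)
  rw [familyIntensity, familyIntensity, familyIntensity, ← restrict_Ioi_mconv hnonneg,
    Measure.mconv, Measure.prod_sum, Measure.map_sum (by fun_prop)]
  exact congrArg (fun m => (Measure.sum m).restrict (Set.Ioi 0)) (funext fun p => hW p.1 p.2)

end FamilyIntensity

section Words

variable {ι : Type*}

theorem tsum_pi_prod_eq_prod_tsum {k : ℕ} {τ : Fin k → Type*} (x : ∀ i, τ i → ℝ≥0∞) :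
    ∑' f : ∀ i, τ i, ∏ i, x i (f i) = ∏ i, ∑' d, x i d := by
  induction k with
  | zero => simp
  | succ k ih =>
    rw [← (Fin.consEquiv τ).tsum_eq, ENNReal.tsum_prod']
    simp only [Fin.consEquiv_apply, Fin.prod_univ_succ, Fin.cons_zero, Fin.cons_succ,
      ENNReal.tsum_mul_left, ih, ENNReal.tsum_mul_right]

theorem tsum_list_prod_map (x : ι → ℝ≥0∞) :
    ∑' u : List ι, (u.map x).prod = (1 - ∑' i, x i)⁻¹ := by
  have hlength : ∀ k, ∑' f : Fin k → ι, ((List.ofFn f).map x).prod = (∑' i, x i) ^ k := by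
    intro k
    simpa only [List.map_ofFn, List.prod_ofFn, Function.comp_apply, Finset.prod_const,
      Finset.card_univ, Fintype.card_fin] using tsum_pi_prod_eq_prod_tsum fun _ : Fin k => x
  rw [← List.equivSigmaTuple.symm.tsum_eq, ENNReal.tsum_sigma', ← ENNReal.tsum_geometric]
  exact tsum_congr hlength

theorem tsum_list_eq_add_tsum_cons (f : List ι → ℝ≥0∞) :
    ∑' u, f u = f [] + ∑' p : List ι × ι, f (p.2 :: p.1) := by
  have hinj : Function.Injective fun p : List ι × ι => p.2 :: p.1 := fun _ _ h =>
    Prod.ext (List.cons.inj h).2 (List.cons.inj h).1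
  rw [ENNReal.tsum_eq_add_tsum_ite []]
  refine congrArg (f [] + ·) ((hinj.tsum_eq ?_).symm.trans (by simp))
  rintro (_ | ⟨i, u⟩) hu
  · simp at hu
  · exact ⟨(u, i), rfl⟩

end Words

section Division

theorem measurable_crumb_iSup {Ω : Type*} (S : List ℕ → Ω → (ℕ → ℝ) × (ℕ → ℝ)) (u : List ℕ) :
    Measurable[⨆ v ∈ {v : List ℕ | v.length < u.length}, MeasurableSpace.comap (S v) inferInstance]
      (crumb S u) := by
  induction u with
  | nil => exact measurable_const
  | cons i u ih =>
    have hmono : (⨆ v ∈ {v : List ℕ | v.length < u.length},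
        MeasurableSpace.comap (S v) inferInstance) ≤
        ⨆ v ∈ {v : List ℕ | v.length < (i :: u).length},
          MeasurableSpace.comap (S v) inferInstance :=
      biSup_mono fun v (hv : v.length < u.length) => hv.trans (by simp)
    have hu : MeasurableSpace.comap (S u) inferInstance ≤
        ⨆ v ∈ {v : List ℕ | v.length < (i :: u).length},
          MeasurableSpace.comap (S v) inferInstance :=
      le_biSup (fun v => MeasurableSpace.comap (S v) inferInstance)
        (show u.length < (i :: u).length by simp)
    have hfactor : Measurable[MeasurableSpace.comap (S u) inferInstance] fun ω => (S u ω).1 i :=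
      (measurable_pi_apply i).comp (measurable_fst.comp (comap_measurable (S u)))
    exact (ih.mono hmono le_rfl).mul (hfactor.mono hu le_rfl)

variable {Ω₀ Ω : Type*} [MeasurableSpace Ω₀] [MeasurableSpace Ω] {P₀ : Measure Ω₀}
  {μ : Measure Ω} {X Y : ℕ → Ω₀ → ℝ} {S : List ℕ → Ω → (ℕ → ℝ) × (ℕ → ℝ)}

namespace IsDivision

theorem measurable_crumb (hS : IsDivision P₀ X Y μ S) (u : List ℕ) : Measurable (crumb S u) :=
  (measurable_crumb_iSup S u).mono (iSup₂_le fun v _ => (hS.measurable v).comap_le) le_rfl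

theorem indepFun_crumb (hS : IsDivision P₀ X Y μ S) (u : List ℕ) :
    IndepFun (crumb S u) (S u) μ := by
  have hindep := indep_iSup_of_disjoint (fun v => (hS.measurable v).comap_le) hS.indep
    (S := {v : List ℕ | v.length < u.length}) (T := {u}) (by simp)
  simp only [Set.mem_singleton_iff, iSup_iSup_eq_left] at hindep
  rw [IndepFun_iff_Indep]
  exact indep_of_indep_of_le_left hindep (measurable_crumb_iSup S u).comap_le

theorem map_crumb_mul [IsFiniteMeasure μ] (hS : IsDivision P₀ X Y μ S) (u : List ℕ)
    {p : (ℕ → ℝ) × (ℕ → ℝ) → ℝ} (hp : Measurable p) :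
    μ.map (fun ω => crumb S u ω * p (S u ω)) =
      μ.map (crumb S u) ∗ₘ P₀.map fun ω => p (fun i => X i ω, fun j => Y j ω) := by
  have hlaw : μ.map (p ∘ S u) = P₀.map fun ω => p (fun i => X i ω, fun j => Y j ω) :=
    ((hS.identDistrib u).comp hp).map_eq
  rw [← hlaw]
  exact ((hS.indepFun_crumb u).comp measurable_id hp).map_mul_eq_map_mconv_map
    (hS.measurable_crumb u) (hp.comp (hS.measurable u))

theorem ae_mem_Icc (hS : IsDivision P₀ X Y μ S) (hXY : IsSplitting P₀ X Y) (u : List ℕ) :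
    ∀ᵐ ω ∂μ, (∀ i, (S u ω).1 i ∈ Set.Icc (0 : ℝ) 1) ∧ ∀ j, (S u ω).2 j ∈ Set.Icc (0 : ℝ) 1 := by
  have hmem := (hS.identDistrib u).symm.ae_mem_snd
    (t := (Set.univ.pi fun _ => Set.Icc (0 : ℝ) 1) ×ˢ (Set.univ.pi fun _ => Set.Icc (0 : ℝ) 1))
    ((MeasurableSet.univ_pi fun _ => measurableSet_Icc).prod
      (MeasurableSet.univ_pi fun _ => measurableSet_Icc)) (by
        filter_upwards [hXY.mem_Icc_X, hXY.mem_Icc_Y] with ω hX hY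
        exact ⟨fun i _ => hX i, fun j _ => hY j⟩)
  filter_upwards [hmem] with ω h
  exact ⟨fun i => h.1 i trivial, fun j => h.2 j trivial⟩

theorem ae_crumb_mem_Icc (hS : IsDivision P₀ X Y μ S) (hXY : IsSplitting P₀ X Y) (u : List ℕ) :
    ∀ᵐ ω ∂μ, crumb S u ω ∈ Set.Icc (0 : ℝ) 1 := by
  induction u with
  | nil => exact ae_of_all _ fun ω => ⟨zero_le_one, le_rfl⟩
  | cons i u ih =>
    filter_upwards [ih, hS.ae_mem_Icc hXY u] with ω hu hi
    exact unitInterval.mul_mem hu (hi.1 i)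

theorem ae_solid_mem_Icc (hS : IsDivision P₀ X Y μ S) (hXY : IsSplitting P₀ X Y)
    (c : List ℕ × ℕ) : ∀ᵐ ω ∂μ, solid S c ω ∈ Set.Icc (0 : ℝ) 1 := by
  filter_upwards [hS.ae_crumb_mem_Icc hXY c.1, hS.ae_mem_Icc hXY c.1] with ω hu hj
  exact unitInterval.mul_mem hu (hj.2 c.2)

variable [IsProbabilityMeasure P₀] [IsProbabilityMeasure μ]

theorem familyIntensity_solid (hS : IsDivision P₀ X Y μ S) (hXY : IsSplitting P₀ X Y) :
    familyIntensity μ (solid S) = familyIntensity μ (crumb S) ∗ₘ intensity P₀ Y :=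
  familyIntensity_eq_mconv hS.measurable_crumb
    (fun u => (hS.ae_crumb_mem_Icc hXY u).mono fun ω h => h.1)
    fun u j => hS.map_crumb_mul u (p := fun p => p.2 j) (by fun_prop)

theorem familyIntensity_crumb (hS : IsDivision P₀ X Y μ S) (hXY : IsSplitting P₀ X Y) :
    familyIntensity μ (crumb S) =
      Measure.dirac 1 + familyIntensity μ (crumb S) ∗ₘ intensity P₀ X := by
  have hchildren : familyIntensity μ (fun p : List ℕ × ℕ => crumb S (p.2 :: p.1)) =
      familyIntensity μ (crumb S) ∗ₘ intensity P₀ X :=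
    familyIntensity_eq_mconv hS.measurable_crumb
      (fun u => (hS.ae_crumb_mem_Icc hXY u).mono fun ω h => h.1)
      fun u i => hS.map_crumb_mul u (p := fun p => p.1 i) (by fun_prop)
  have hroot : μ.map (crumb S []) = Measure.dirac 1 := by
    change μ.map (fun _ => 1) = _
    simp
  rw [← hchildren]
  have hdirac : (Measure.dirac (1 : ℝ)).restrict (Set.Ioi 0) = Measure.dirac 1 :=
    Measure.restrict_eq_self_of_ae_mem (by simp)
  rw [familyIntensity, familyIntensity, ← hdirac, ← Measure.restrict_add, ← hroot]
  congr 1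
  ext s hs
  simp only [Measure.sum_apply _ hs, Measure.add_apply, tsum_list_eq_add_tsum_cons]

theorem lintegral_rpow_crumb (hS : IsDivision P₀ X Y μ S) (hXY : IsSplitting P₀ X Y)
    {a : ℝ} (ha : 0 ≤ a) (u : List ℕ) : ∫⁻ ω, ENNReal.ofReal (crumb S u ω) ^ a ∂μ =
      (u.map fun i => ∫⁻ ω, ENNReal.ofReal (X i ω) ^ a ∂P₀).prod := by
  have hpow : Measurable fun x : ℝ => ENNReal.ofReal x ^ a := by fun_prop
  induction u with
  | nil => simp [crumb]
  | cons i u ih =>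
    have hu : ∀ᵐ x ∂μ.map (crumb S u), 0 ≤ x :=
      (ae_map_iff (hS.measurable_crumb u).aemeasurable measurableSet_Ici).mpr
        ((hS.ae_crumb_mem_Icc hXY u).mono fun ω h => h.1)
    have hmap : μ.map (crumb S (i :: u)) = μ.map (crumb S u) ∗ₘ P₀.map (X i) :=
      hS.map_crumb_mul u (p := fun p => p.1 i) (by fun_prop)
    rw [List.map_cons, List.prod_cons, ← ih, ← lintegral_map hpow (hS.measurable_crumb _), hmap,
      lintegral_rpow_mconv hu ha, lintegral_map hpow (hS.measurable_crumb u),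
      lintegral_map hpow (hXY.measurable_X i), mul_comm]

theorem integrable_rpow_crumb (hS : IsDivision P₀ X Y μ S) (hXY : IsSplitting P₀ X Y) {a : ℝ}
    (ha : 0 < a) (hX : Integrable (fun x : ℝ => x ^ a) (intensity P₀ X))
    (hX1 : ∫ x, x ^ a ∂intensity P₀ X < 1) :
    Integrable (fun x : ℝ => x ^ a) (familyIntensity μ (crumb S)) := by
  have hlt : ∑' i, ∫⁻ ω, ENNReal.ofReal (X i ω) ^ a ∂P₀ < 1 := by
    rw [← lintegral_rpow_familyIntensity hXY.measurable_X ha,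
      ← ofReal_integral_rpow (ae_familyIntensity_pos P₀ X) hX]
    exact ENNReal.ofReal_lt_one.mpr hX1
  rw [integrable_rpow_iff_lintegral_ne_top (ae_familyIntensity_pos μ (crumb S)),
    lintegral_rpow_familyIntensity hS.measurable_crumb ha,
    tsum_congr (hS.lintegral_rpow_crumb hXY ha.le), tsum_list_prod_map]
  exact ENNReal.inv_ne_top.mpr (tsub_pos_of_lt hlt).ne'

theorem integrable_rpow_solid (hS : IsDivision P₀ X Y μ S) (hXY : IsSplitting P₀ X Y) {a : ℝ}
    (ha : 0 < a) (hX : Integrable (fun x : ℝ => x ^ a) (intensity P₀ X))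
    (hX1 : ∫ x, x ^ a ∂intensity P₀ X < 1)
    (hY : Integrable (fun x : ℝ => x ^ a) (intensity P₀ Y)) :
    Integrable (fun x : ℝ => x ^ a) (familyIntensity μ (solid S)) := by
  rw [intensity_eq_familyIntensity P₀ Y] at hY
  rw [hS.familyIntensity_solid hXY]
  exact integrable_rpow_mconv (ae_familyIntensity_pos μ _) (ae_familyIntensity_pos P₀ Y)
    (hS.integrable_rpow_crumb hXY ha hX hX1) hY

theorem mellinTransform_crumb_mul_one_sub (hS : IsDivision P₀ X Y μ S)
    (hXY : IsSplitting P₀ X Y) {s : ℂ} (hs : 0 < s.re)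
    (hX : Integrable (fun x : ℝ => x ^ s.re) (intensity P₀ X))
    (hX1 : ∫ x, x ^ s.re ∂intensity P₀ X < 1) :
    mellinTransform (familyIntensity μ (crumb S)) s * (1 - mellinTransform (intensity P₀ X) s) =
      1 := by
  have hcrumb := hS.integrable_rpow_crumb hXY hs hX hX1
  have hX0 : ∀ᵐ x ∂familyIntensity P₀ X, 0 < x := ae_familyIntensity_pos P₀ X
  have hcrumb0 := ae_familyIntensity_pos μ (crumb S)
  have hrenewal := hS.familyIntensity_crumb hXY
  rw [intensity_eq_familyIntensity] at hrenewal hX ⊢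
  have hone : Integrable (fun x : ℝ => (x : ℂ) ^ s) (Measure.dirac 1) := integrable_dirac (by simp)
  have hchildren : Integrable (fun x : ℝ => (x : ℂ) ^ s)
      (familyIntensity μ (crumb S) ∗ₘ familyIntensity P₀ X) :=
    (integrable_add_measure.mp (hrenewal ▸ integrable_cpow hcrumb0 hcrumb)).2
  have hfixed : mellinTransform (familyIntensity μ (crumb S)) s = 1 +
      mellinTransform (familyIntensity μ (crumb S)) s *
        mellinTransform (familyIntensity P₀ X) s := by
    rw [← mellinTransform_mconv hcrumb0 hX0]
    nth_rewrite 1 [mellinTransform, hrenewal]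
    rw [integral_add_measure hone hchildren, integral_dirac, Complex.ofReal_one,
      Complex.one_cpow, mellinTransform]
  linear_combination hfixed

theorem mellinTransform_solid (hS : IsDivision P₀ X Y μ S) (hXY : IsSplitting P₀ X Y) {s : ℂ}
    (hs : 0 < s.re) (hX : Integrable (fun x : ℝ => x ^ s.re) (intensity P₀ X))
    (hX1 : ∫ x, x ^ s.re ∂intensity P₀ X < 1) :
    mellinTransform (familyIntensity μ (solid S)) s =
      mellinTransform (intensity P₀ Y) s / (1 - mellinTransform (intensity P₀ X) s) := by
  have hcrumb := hS.mellinTransform_crumb_mul_one_sub hXY hs hX hX1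
  rw [eq_div_iff (right_ne_zero_of_mul_eq_one hcrumb), hS.familyIntensity_solid hXY,
    intensity_eq_familyIntensity P₀ Y,
    mellinTransform_mconv (ae_familyIntensity_pos μ _) (ae_familyIntensity_pos P₀ Y)]
  linear_combination mellinTransform (familyIntensity P₀ Y) s * hcrumb

end IsDivision

end Division

section Exponent

theorem familyIntensity_univ {Ω ι : Type*} [MeasurableSpace Ω] [Countable ι] {μ : Measure Ω}
    {Z : ι → Ω → ℝ} (hZ : ∀ i, Measurable (Z i)) : familyIntensity μ Z Set.univ =
      ∫⁻ ω, (({i | 0 < Z i ω} : Set ι).encard : ℝ≥0∞) ∂μ := by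
  have hcount : ∀ ω, (({i | 0 < Z i ω} : Set ι).encard : ℝ≥0∞) =
      ∑' i, (Set.Ioi (0 : ℝ)).indicator 1 (Z i ω) := fun ω => by
    rw [← ENNReal.tsum_set_one, tsum_subtype {i | 0 < Z i ω} fun _ => (1 : ℝ≥0∞)]
    rfl
  have hind : Measurable ((Set.Ioi (0 : ℝ)).indicator (1 : ℝ → ℝ≥0∞)) :=
    measurable_one.indicator measurableSet_Ioi
  have hind0 : ∀ x ≤ (0 : ℝ), (Set.Ioi (0 : ℝ)).indicator (1 : ℝ → ℝ≥0∞) x = 0 := fun x hx =>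
    Set.indicator_of_notMem (not_lt.mpr hx) 1
  have hsum := lintegral_familyIntensity (μ := μ) hZ hind hind0
  rw [lintegral_indicator_one measurableSet_Ioi, familyIntensity,
    Measure.restrict_apply_self] at hsum
  rw [lintegral_congr hcount, lintegral_tsum fun i => (hind.fun_comp (hZ i)).aemeasurable, ← hsum,
    familyIntensity, Measure.restrict_apply_univ]

theorem lintegral_rpow_le_lintegral_rpow {m : Measure ℝ} (hm : ∀ᵐ x ∂m, x ∈ Set.Ioc (0 : ℝ) 1)
    {a b : ℝ} (hab : a ≤ b) :
    ∫⁻ x, ENNReal.ofReal x ^ b ∂m ≤ ∫⁻ x, ENNReal.ofReal x ^ a ∂m :=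
  lintegral_mono_ae (hm.mono fun _ hx =>
    ENNReal.rpow_le_rpow_of_exponent_ge (ENNReal.ofReal_le_one.mpr hx.2) hab)

variable {Ω₀ : Type*} [MeasurableSpace Ω₀] {P₀ : Measure Ω₀} {X Y : ℕ → Ω₀ → ℝ}

theorem Malthusian.lintegral_rpow_eq_one {σ ν : Measure ℝ} {α ε : ℝ} (hM : Malthusian σ ν α ε)
    (hσ : ∀ᵐ x ∂σ, 0 < x) : ∫⁻ x, ENNReal.ofReal x ^ α ∂σ = 1 := by
  rw [← ofReal_integral_rpow hσ (hM.psi_finite α (sub_lt_self α hM.eps_pos)),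
    hM.integral_rpow_eq_one hσ, ENNReal.ofReal_one]

namespace IsSplitting

theorem ae_intensity_X_mem_Ioc (hXY : IsSplitting P₀ X Y) :
    ∀ᵐ x ∂intensity P₀ X, x ∈ Set.Ioc (0 : ℝ) 1 :=
  ae_familyIntensity_mem_Ioc hXY.measurable_X (ae_all_iff.mp hXY.mem_Icc_X)

theorem ae_intensity_Y_mem_Ioc (hXY : IsSplitting P₀ X Y) :
    ∀ᵐ x ∂intensity P₀ Y, x ∈ Set.Ioc (0 : ℝ) 1 :=
  ae_familyIntensity_mem_Ioc hXY.measurable_Y (ae_all_iff.mp hXY.mem_Icc_Y)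

theorem exponent_pos (hXY : IsSplitting P₀ X Y) {ν : Measure ℝ} {α ε : ℝ}
    (hM : Malthusian (intensity P₀ X) ν α ε) : 0 < α := by
  by_contra! hα
  have hcount := hXY.supercritical
  rw [← familyIntensity_univ hXY.measurable_X, ← intensity_eq_familyIntensity,
    ← hM.lintegral_rpow_eq_one (ae_familyIntensity_pos P₀ X)] at hcount
  refine hcount.not_ge ?_
  simpa only [ENNReal.rpow_zero, lintegral_one] using
    lintegral_rpow_le_lintegral_rpow hXY.ae_intensity_X_mem_Ioc hα

theorem exponent_lt_one (hXY : IsSplitting P₀ X Y) {ν : Measure ℝ} {α ε : ℝ}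
    (hM : Malthusian (intensity P₀ X) ν α ε) : α < 1 := by
  by_contra! hα
  have hmean := hXY.mean_crumbs_lt_one
  rw [lintegral_tsum fun i => (hXY.measurable_X i).ennreal_ofReal.aemeasurable,
    ← lintegral_familyIntensity hXY.measurable_X ENNReal.measurable_ofReal
      fun _ => ENNReal.ofReal_of_nonpos, ← intensity_eq_familyIntensity,
    ← hM.lintegral_rpow_eq_one (ae_familyIntensity_pos P₀ X)] at hmean
  refine hmean.not_ge ?_
  simpa only [ENNReal.rpow_one] using
    lintegral_rpow_le_lintegral_rpow hXY.ae_intensity_X_mem_Ioc hα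

end IsSplitting

end Exponent

section Paintbox

theorem two_mul_le_sq_add_one (x : ℝ≥0∞) : 2 * x ≤ x ^ 2 + 1 := by
  induction x with
  | top => simp
  | coe x =>
    have hreal := two_mul_le_add_sq x 1
    rw [mul_one, one_pow] at hreal
    exact_mod_cast hreal

theorem eq_one_of_two_mul_eq_sq_add_one {x : ℝ≥0∞} (hx : x ≠ ∞) (h : 2 * x = x ^ 2 + 1) :
    x = 1 := by
  lift x to NNReal using hx
  have hreal : 2 * (x : ℝ) = (x : ℝ) ^ 2 + 1 := by exact_mod_cast h
  exact_mod_cast (by nlinarith [sq_nonneg ((x : ℝ) - 1)] : (x : ℝ) = 1)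

theorem ae_eq_one_of_lintegral_eq_one {Ω : Type*} [MeasurableSpace Ω] {μ : Measure Ω}
    [IsProbabilityMeasure μ] {f : Ω → ℝ≥0∞} (hf : Measurable f) (h1 : ∫⁻ ω, f ω ∂μ = 1)
    (h2 : ∫⁻ ω, f ω ^ 2 ∂μ = 1) : f =ᵐ[μ] 1 := by
  have hleft : ∫⁻ ω, 2 * f ω ∂μ = 2 := by rw [lintegral_const_mul _ hf, h1, mul_one]
  have hright : ∫⁻ ω, f ω ^ 2 + 1 ∂μ = 2 := by
    rw [lintegral_add_left (hf.pow_const 2), h2, lintegral_one, measure_univ, one_add_one_eq_two]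
  have heq := ae_eq_of_ae_le_of_lintegral_le (ae_of_all μ fun ω => two_mul_le_sq_add_one (f ω))
    (by simp [hleft]) ((hf.pow_const 2).add_const 1).aemeasurable (hright.trans hleft.symm).le
  filter_upwards [heq, ae_lt_top hf (by simp [h1])] with ω hω hfin
  exact eq_one_of_two_mul_eq_sq_add_one hfin.ne hω

variable {Ω κ : Type*} {C : ℕ → Ω → κ}

/-- The event that, among the first `n` balls, those of colour `c` are exactly the balls in `A`.
Both `numColors` and `numColorsMult` are counted by such events. -/
def exactEvent (C : ℕ → Ω → κ) (n : ℕ) (A : Finset (Fin n)) (c : κ) : Set Ω :=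
  {ω | ∀ k : Fin n, C k ω = c ↔ k ∈ A}

theorem exactEvent_eq (C : ℕ → Ω → κ) (n : ℕ) (A : Finset (Fin n)) (c : κ) :
    exactEvent C n A c = {ω | ∀ k : Fin n, C k ω ∈ if k ∈ A then ({c} : Set κ) else {c}ᶜ} := by
  ext ω
  refine forall_congr' fun k => ?_
  split_ifs with hk <;> simp [hk]

namespace IsPaintboxSample

variable [MeasurableSpace Ω] {μ : Measure Ω} {P : κ → Ω → ℝ}

theorem measurableSet_box [Countable κ] (hC : IsPaintboxSample μ P C) {n : ℕ}
    (T : Fin n → Set κ) : MeasurableSet {ω | ∀ k : Fin n, C k ω ∈ T k} := by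
  have hbox : {ω | ∀ k : Fin n, C k ω ∈ T k} = ⋂ k : Fin n, ⋃ d ∈ T k, {ω | C k ω = d} := by
    ext
    simp
  rw [hbox]
  exact MeasurableSet.iInter fun k => MeasurableSet.biUnion (Set.to_countable _)
    fun d _ => hC.measurableSet_color k d

theorem measurableSet_exactEvent [Countable κ] (hC : IsPaintboxSample μ P C) (n : ℕ)
    (A : Finset (Fin n)) (c : κ) : MeasurableSet (exactEvent C n A c) := by
  rw [exactEvent_eq]
  exact hC.measurableSet_box _

theorem measurable_indicator_exactEvent [Countable κ] (hC : IsPaintboxSample μ P C) (n : ℕ)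
    (A : Finset (Fin n)) (c : κ) :
    Measurable ((exactEvent C n A c).indicator (1 : Ω → ℝ≥0∞)) :=
  measurable_one.indicator (hC.measurableSet_exactEvent n A c)

variable [Countable κ] [IsProbabilityMeasure μ]

theorem measure_cylinder (hC : IsPaintboxSample μ P C)
    (hP : ∀ c, ∀ᵐ ω ∂μ, P c ω ∈ Set.Icc (0 : ℝ) 1) {n : ℕ} (t : Fin n → κ) :
    μ {ω | ∀ k : Fin n, C k ω = t k} = ∫⁻ ω, ∏ k, ENNReal.ofReal (P (t k) ω) ∂μ := by
  have hcomap : MeasurableSpace.comap (fun ω d => P d ω) MeasurableSpace.pi ≤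
      (inferInstance : MeasurableSpace Ω) :=
    (measurable_pi_lambda _ hC.measurable_box).comap_le
  have hnonneg : ∀ᵐ ω ∂μ, ∀ k, 0 ≤ P (t k) ω :=
    ae_all_iff.mpr fun k => (hP (t k)).mono fun ω h => h.1
  have hmeas : MeasurableSet {ω | ∀ k : Fin n, C k ω = t k} :=
    hC.measurableSet_box fun k => {t k}
  have hreal : μ.real {ω | ∀ k : Fin n, C k ω = t k} = ∫ ω, ∏ k, P (t k) ω ∂μ := by
    rw [← integral_congr_ae (hC.cond_law n t), integral_condExp hcomap,
      integral_indicator_const (1 : ℝ) hmeas, smul_eq_mul, mul_one]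
  rw [← ofReal_measureReal, hreal,
    ofReal_integral_eq_lintegral_ofReal (integrable_condExp.congr (hC.cond_law n t))
      (hnonneg.mono fun ω h => Finset.prod_nonneg fun k _ => h k)]
  exact lintegral_congr_ae (hnonneg.mono fun ω h => ENNReal.ofReal_prod_of_nonneg fun k _ => h k)

theorem measure_box (hC : IsPaintboxSample μ P C)
    (hP : ∀ c, ∀ᵐ ω ∂μ, P c ω ∈ Set.Icc (0 : ℝ) 1) {n : ℕ} (T : Fin n → Set κ) :
    μ {ω | ∀ k : Fin n, C k ω ∈ T k} = ∫⁻ ω, ∏ k, ∑' d : T k, ENNReal.ofReal (P d ω) ∂μ := by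
  have hbox : {ω | ∀ k : Fin n, C k ω ∈ T k} =
      ⋃ t : ∀ k, T k, {ω | ∀ k : Fin n, C k ω = t k} := by
    ext ω
    simp only [Set.mem_ofPred_eq, Set.mem_iUnion]
    exact ⟨fun h => ⟨fun k => ⟨C k ω, h k⟩, fun k => rfl⟩,
      fun ⟨t, ht⟩ k => (ht k).symm ▸ (t k).2⟩
  have hdisjoint : Pairwise (Function.onFun Disjoint
      fun t : ∀ k, T k => {ω | ∀ k : Fin n, C k ω = t k}) := fun s t hst =>
    Set.disjoint_left.mpr fun ω hs ht =>
      hst (funext fun k => Subtype.ext ((hs k).symm.trans (ht k)))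
  simp_rw [← tsum_pi_prod_eq_prod_tsum]
  rw [hbox, measure_iUnion hdisjoint fun t => hC.measurableSet_box fun k => {(t k : κ)},
    lintegral_tsum fun t => (Finset.measurable_fun_prod _ fun k _ =>
      (hC.measurable_box (t k)).ennreal_ofReal).aemeasurable]
  exact tsum_congr fun t => hC.measure_cylinder hP _

theorem ae_tsum_eq_one (hC : IsPaintboxSample μ P C)
    (hP : ∀ c, ∀ᵐ ω ∂μ, P c ω ∈ Set.Icc (0 : ℝ) 1) :
    ∀ᵐ ω ∂μ, ∑' c, ENNReal.ofReal (P c ω) = 1 := by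
  have hmoment : ∀ n : ℕ, ∫⁻ ω, (∑' c, ENNReal.ofReal (P c ω)) ^ n ∂μ = 1 := fun n => by
    have huniv : ∀ ω, ∑' d : (Set.univ : Set κ), ENNReal.ofReal (P d ω) =
        ∑' d, ENNReal.ofReal (P d ω) := fun ω => tsum_univ fun d => ENNReal.ofReal (P d ω)
    have hbox := hC.measure_box hP fun _ : Fin n => Set.univ
    simp_rw [huniv] at hbox
    simpa using hbox.symm
  exact ae_eq_one_of_lintegral_eq_one
    (Measurable.tsum fun d => (hC.measurable_box d).ennreal_ofReal)
    (by simpa only [pow_one] using hmoment 1) (hmoment 2)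

theorem measure_exactEvent (hC : IsPaintboxSample μ P C)
    (hP : ∀ c, ∀ᵐ ω ∂μ, P c ω ∈ Set.Icc (0 : ℝ) 1) (n : ℕ) (A : Finset (Fin n)) (c : κ) :
    μ (exactEvent C n A c) =
      ∫⁻ ω, ENNReal.ofReal (P c ω) ^ A.card * (1 - ENNReal.ofReal (P c ω)) ^ (n - A.card) ∂μ := by
  rw [exactEvent_eq, hC.measure_box hP]
  refine lintegral_congr_ae ?_
  filter_upwards [hC.ae_tsum_eq_one hP] with ω hω
  have hself : ∑' d : ({c} : Set κ), ENNReal.ofReal (P d ω) = ENNReal.ofReal (P c ω) :=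
    tsum_singleton c fun d => ENNReal.ofReal (P d ω)
  have hothers : ∑' d : ({c}ᶜ : Set κ), ENNReal.ofReal (P d ω) = 1 - ENNReal.ofReal (P c ω) := by
    refine ENNReal.eq_sub_of_add_eq' ENNReal.one_ne_top ?_
    rw [← hself, ← hω, add_comm]
    exact Summable.tsum_add_tsum_compl (f := fun d => ENNReal.ofReal (P d ω)) ENNReal.summable
      ENNReal.summable
  have hfactor : ∀ k : Fin n,
      ∑' d : (if k ∈ A then ({c} : Set κ) else {c}ᶜ : Set κ), ENNReal.ofReal (P d ω) =
      if k ∈ A then ENNReal.ofReal (P c ω) else 1 - ENNReal.ofReal (P c ω) := fun k => by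
    by_cases hk : k ∈ A
    · rw [if_pos hk, if_pos hk, hself]
    · rw [if_neg hk, if_neg hk, hothers]
  rw [Finset.prod_congr rfl fun k _ => hfactor k, Finset.prod_ite, Finset.prod_const,
    Finset.prod_const, Finset.filter_univ_mem, Finset.filter_not, Finset.filter_univ_mem,
    ← Finset.compl_eq_univ_sdiff, Finset.card_compl, Fintype.card_fin]

theorem tsum_measure_exactEvent (hC : IsPaintboxSample μ P C)
    (hP : ∀ c, ∀ᵐ ω ∂μ, P c ω ∈ Set.Icc (0 : ℝ) 1) (n : ℕ) {A : Finset (Fin n)}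
    (hA : A.Nonempty) :
    ∑' c, μ (exactEvent C n A c) =
      ∫⁻ x, ENNReal.ofReal x ^ A.card * (1 - ENNReal.ofReal x) ^ (n - A.card)
        ∂familyIntensity μ P := by
  rw [lintegral_familyIntensity hC.measurable_box (by fun_prop) fun x hx => by
    simp [ENNReal.ofReal_of_nonpos hx, hA.ne_empty]]
  exact tsum_congr fun c => hC.measure_exactEvent hP n A c

end IsPaintboxSample

theorem mem_exactEvent_iff [DecidableEq κ] {n : ℕ} {A : Finset (Fin n)} {c : κ} {ω : Ω} :
    ω ∈ exactEvent C n A c ↔ (Finset.univ.filter fun k : Fin n => C k ω = c) = A := by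
  simp [exactEvent, Finset.ext_iff]

theorem sum_indicator_exactEvent [DecidableEq κ] (C : ℕ → Ω → κ) (n r : ℕ) (c : κ) (ω : Ω) :
    ∑ A ∈ Finset.powersetCard r (Finset.univ : Finset (Fin n)),
        (exactEvent C n A c).indicator (1 : Ω → ℝ≥0∞) ω =
      if ((Finset.range n).filter fun k => C k ω = c).card = r then 1 else 0 := by
  have hcard : ((Finset.range n).filter fun k => C k ω = c).card =
      (Finset.univ.filter fun k : Fin n => C k ω = c).card := by
    rw [Finset.card_filter, Finset.card_filter, Finset.sum_range]
  have hind : ∀ A : Finset (Fin n), (exactEvent C n A c).indicator (1 : Ω → ℝ≥0∞) ω =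
      if (Finset.univ.filter fun k : Fin n => C k ω = c) = A then 1 else 0 := fun A => by
    classical
    rw [Set.indicator_apply]
    exact if_congr mem_exactEvent_iff rfl rfl
  simp only [hind, Finset.sum_ite_eq, hcard, Finset.mem_powersetCard, Finset.subset_univ, true_and]

theorem numColorsMult_eq_tsum [DecidableEq κ] (C : ℕ → Ω → κ) (n : ℕ) {r : ℕ} (hr : r ≠ 0)
    (ω : Ω) : (numColorsMult C n r ω : ℝ≥0∞) =
      ∑' c, ∑ A ∈ Finset.powersetCard r (Finset.univ : Finset (Fin n)),
        (exactEvent C n A c).indicator 1 ω := by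
  simp_rw [sum_indicator_exactEvent]
  rw [tsum_eq_sum (s := (Finset.range n).image fun k => C k ω), numColorsMult, Finset.card_filter]
  · push_cast
    rfl
  · intro c hc
    have hempty : ((Finset.range n).filter fun k => C k ω = c) = ∅ :=
      Finset.filter_eq_empty_iff.mpr fun k hk h => hc (Finset.mem_image.mpr ⟨k, hk, h⟩)
    simp [hempty, hr.symm]

theorem mem_exactEvent_last_iff [DecidableEq κ] {n : ℕ} {c : κ} {ω : Ω} :
    ω ∈ exactEvent C (n + 1) {Fin.last n} c ↔
      c = C n ω ∧ C n ω ∉ (Finset.range n).image fun k => C k ω := by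
  simp only [exactEvent, Set.mem_ofPred_eq, Fin.forall_fin_succ', Finset.mem_singleton,
    Fin.val_castSucc, Fin.val_last, (Fin.castSucc_lt_last _).ne, iff_false, iff_true,
    Fin.forall_iff, Finset.mem_image, Finset.mem_range, not_exists, not_and]
  constructor
  · rintro ⟨hold, rfl⟩
    exact ⟨rfl, hold⟩
  · rintro ⟨rfl, hold⟩
    exact ⟨hold, rfl⟩

theorem numColors_succ [DecidableEq κ] (C : ℕ → Ω → κ) (n : ℕ) (ω : Ω) :
    (numColors C (n + 1) ω : ℝ≥0∞) = numColors C n ω +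
      ∑' c, (exactEvent C (n + 1) {Fin.last n} c).indicator 1 ω := by
  rw [tsum_eq_single (C n ω) fun c hc => by simp [mem_exactEvent_last_iff, hc], numColors,
    numColors, Finset.range_add_one, Finset.image_insert]
  by_cases hold : C n ω ∈ (Finset.range n).image fun k => C k ω
  · rw [Finset.insert_eq_of_mem hold,
      Set.indicator_of_notMem fun h => (mem_exactEvent_last_iff.mp h).2 hold, add_zero]
  · rw [Finset.card_insert_of_notMem hold,
      Set.indicator_of_mem (mem_exactEvent_last_iff.mpr ⟨rfl, hold⟩)]
    push_cast
    rfl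

namespace IsPaintboxSample

variable [MeasurableSpace Ω] {μ : Measure Ω} {P : κ → Ω → ℝ} [Countable κ] [DecidableEq κ]

theorem measurable_numColorsMult (hC : IsPaintboxSample μ P C) (n : ℕ) {r : ℕ} (hr : r ≠ 0) :
    Measurable fun ω => (numColorsMult C n r ω : ℝ≥0∞) := by
  simp_rw [numColorsMult_eq_tsum C n hr]
  exact Measurable.tsum fun c => Finset.measurable_fun_sum _ fun A _ =>
    hC.measurable_indicator_exactEvent n A c

theorem measurable_numColors (hC : IsPaintboxSample μ P C) (n : ℕ) :
    Measurable fun ω => (numColors C n ω : ℝ≥0∞) := by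
  induction n with
  | zero => simp [numColors]
  | succ n ih =>
    simp_rw [numColors_succ]
    exact ih.add (Measurable.tsum fun c => hC.measurable_indicator_exactEvent _ _ c)

variable [IsProbabilityMeasure μ]

theorem lintegral_numColorsMult (hC : IsPaintboxSample μ P C)
    (hP : ∀ c, ∀ᵐ ω ∂μ, P c ω ∈ Set.Icc (0 : ℝ) 1) (n : ℕ) {r : ℕ} (hr : r ≠ 0) :
    ∫⁻ ω, (numColorsMult C n r ω : ℝ≥0∞) ∂μ = n.choose r *
      ∫⁻ x, ENNReal.ofReal x ^ r * (1 - ENNReal.ofReal x) ^ (n - r) ∂familyIntensity μ P := by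
  have hmeas := hC.measurable_indicator_exactEvent n
  have hterm : ∀ A ∈ Finset.powersetCard r (Finset.univ : Finset (Fin n)),
      ∑' c, μ (exactEvent C n A c) = ∫⁻ x, ENNReal.ofReal x ^ r *
        (1 - ENNReal.ofReal x) ^ (n - r) ∂familyIntensity μ P := fun A hA => by
    obtain ⟨-, rfl⟩ := Finset.mem_powersetCard.mp hA
    exact hC.tsum_measure_exactEvent hP n (Finset.card_ne_zero.mp hr)
  simp_rw [numColorsMult_eq_tsum C n hr]
  rw [lintegral_tsum fun c => (Finset.measurable_fun_sum _ fun A _ => hmeas A c).aemeasurable]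
  simp_rw [lintegral_finsetSum _ fun A _ => hmeas A _,
    lintegral_indicator_one (hC.measurableSet_exactEvent n _ _)]
  rw [Summable.tsum_finsetSum fun A _ => ENNReal.summable, Finset.sum_congr rfl hterm,
    Finset.sum_const, Finset.card_powersetCard, Finset.card_fin, nsmul_eq_mul]

theorem lintegral_numColors (hC : IsPaintboxSample μ P C)
    (hP : ∀ c, ∀ᵐ ω ∂μ, P c ω ∈ Set.Icc (0 : ℝ) 1) (n : ℕ) :
    ∫⁻ ω, (numColors C n ω : ℝ≥0∞) ∂μ = ∑ k ∈ Finset.range n,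
      ∫⁻ x, ENNReal.ofReal x ^ 1 * (1 - ENNReal.ofReal x) ^ k ∂familyIntensity μ P := by
  induction n with
  | zero => simp [numColors]
  | succ n ih =>
    have hnew := hC.tsum_measure_exactEvent hP (n + 1) (Finset.singleton_nonempty (Fin.last n))
    simp_rw [numColors_succ]
    rw [lintegral_add_left (hC.measurable_numColors n), ih, Finset.sum_range_succ,
      lintegral_tsum fun c => (hC.measurable_indicator_exactEvent _ _ c).aemeasurable]
    simp_rw [lintegral_indicator_one (hC.measurableSet_exactEvent _ _ _)]
    rw [hnew, Finset.card_singleton, Nat.add_sub_cancel]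

end IsPaintboxSample

theorem ofReal_integral_pow_mul_one_sub_pow {m : Measure ℝ}
    (hm : ∀ᵐ x ∂m, x ∈ Set.Ioc (0 : ℝ) 1) {c : ℝ} {r : ℕ} (hcr : c ≤ r)
    (hint : Integrable (fun x : ℝ => x ^ c) m) (k : ℕ) :
    ENNReal.ofReal (∫ x, x ^ r * (1 - x) ^ k ∂m) =
      ∫⁻ x, ENNReal.ofReal x ^ r * (1 - ENNReal.ofReal x) ^ k ∂m := by
  rw [ofReal_integral_eq_lintegral_ofReal (integrable_pow_mul_one_sub_pow hm hcr hint k)]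
  · refine lintegral_congr_ae ?_
    filter_upwards [hm] with x hx
    rw [ENNReal.ofReal_mul (pow_nonneg hx.1.le r), ENNReal.ofReal_pow hx.1.le,
      ENNReal.ofReal_pow (sub_nonneg.mpr hx.2), ENNReal.ofReal_sub _ hx.1.le, ENNReal.ofReal_one]
  · exact hm.mono fun x hx => mul_nonneg (pow_nonneg hx.1.le r) (pow_nonneg (sub_nonneg.mpr hx.2) k)

namespace IsPaintboxSample

variable [MeasurableSpace Ω] {μ : Measure Ω} {P : κ → Ω → ℝ} [Countable κ] [DecidableEq κ]
  [IsProbabilityMeasure μ] {c : ℝ}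

theorem integral_numColorsMult (hC : IsPaintboxSample μ P C)
    (hP : ∀ c, ∀ᵐ ω ∂μ, P c ω ∈ Set.Icc (0 : ℝ) 1) {r : ℕ} (hr : r ≠ 0) (hcr : c ≤ r)
    (hint : Integrable (fun x : ℝ => x ^ c) (familyIntensity μ P)) (n : ℕ) :
    ∫ ω, (numColorsMult C n r ω : ℝ) ∂μ =
      n.choose r * ∫ x, x ^ r * (1 - x) ^ (n - r) ∂familyIntensity μ P := by
  have hIoc := ae_familyIntensity_mem_Ioc hC.measurable_box hP
  have htoReal := integral_toReal (hC.measurable_numColorsMult n hr).aemeasurable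
    (ae_of_all μ fun ω => ENNReal.natCast_lt_top _)
  simp only [ENNReal.toReal_natCast] at htoReal
  rw [htoReal, hC.lintegral_numColorsMult hP n hr, ENNReal.toReal_mul, ENNReal.toReal_natCast,
    ← ofReal_integral_pow_mul_one_sub_pow hIoc hcr hint, ENNReal.toReal_ofReal]
  exact integral_nonneg_of_ae (hIoc.mono fun x hx =>
    mul_nonneg (pow_nonneg hx.1.le _) (pow_nonneg (sub_nonneg.mpr hx.2) _))

theorem integral_numColors (hC : IsPaintboxSample μ P C)
    (hP : ∀ c, ∀ᵐ ω ∂μ, P c ω ∈ Set.Icc (0 : ℝ) 1) (hc1 : c ≤ 1)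
    (hint : Integrable (fun x : ℝ => x ^ c) (familyIntensity μ P)) (n : ℕ) :
    ∫ ω, (numColors C n ω : ℝ) ∂μ =
      ∑ k ∈ Finset.range n, ∫ x, x * (1 - x) ^ k ∂familyIntensity μ P := by
  have hIoc := ae_familyIntensity_mem_Ioc hC.measurable_box hP
  have htoReal := integral_toReal (hC.measurable_numColors n).aemeasurable
    (ae_of_all μ fun ω => ENNReal.natCast_lt_top _)
  have hnonneg : ∀ k : ℕ, 0 ≤ ∫ x, x ^ 1 * (1 - x) ^ k ∂familyIntensity μ P := fun k =>
    integral_nonneg_of_ae (hIoc.mono fun x hx =>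
      mul_nonneg (pow_nonneg hx.1.le _) (pow_nonneg (sub_nonneg.mpr hx.2) _))
  have hc1' : c ≤ (1 : ℕ) := by exact_mod_cast hc1
  simp only [ENNReal.toReal_natCast] at htoReal
  simp_rw [htoReal, hC.lintegral_numColors hP,
    ← ofReal_integral_pow_mul_one_sub_pow hIoc hc1' hint,
    ← ENNReal.ofReal_sum_of_nonneg fun k _ => hnonneg k,
    ENNReal.toReal_ofReal (Finset.sum_nonneg fun k _ => hnonneg k), pow_one]

end IsPaintboxSample

end Paintbox

section Asymptotics

namespace IsPaintboxSample

variable {Ω κ : Type*} [MeasurableSpace Ω] [Countable κ] [DecidableEq κ] {μ : Measure Ω}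
  [IsProbabilityMeasure μ] {P : κ → Ω → ℝ} {C : ℕ → Ω → κ} {α β c : ℝ} {A : ℂ}

theorem isBigO_integral_numColorsMult_sub (hC : IsPaintboxSample μ P C)
    (hP : ∀ c, ∀ᵐ ω ∂μ, P c ω ∈ Set.Icc (0 : ℝ) 1)
    (h : HasSimpleMellinPole (familyIntensity μ P) α β c A) (hβα : β ≤ α) (hαβ : α - 1 ≤ β)
    (hαc : α < c) {r : ℕ} (hr : r ≠ 0) (hcr : c < r) :
    (fun n : ℕ => ((∫ ω, (numColorsMult C n r ω : ℝ) ∂μ : ℝ) : ℂ) -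
      (((n : ℝ) ^ α : ℝ) : ℂ) * (Complex.Gamma (r - α) * A / r.factorial))
      =O[atTop] fun n : ℕ => (n : ℝ) ^ β := by
  have hasymp := h.isBigO_descFactorial_mul_integral_sub
    (ae_familyIntensity_mem_Ioc hC.measurable_box hP) hβα hαβ hαc hcr
  refine (hasymp.const_mul_left (r.factorial : ℂ)⁻¹).congr_left fun n => ?_
  have hr0 : (r.factorial : ℂ) ≠ 0 := by exact_mod_cast r.factorial_ne_zero
  rw [hC.integral_numColorsMult hP hr hcr.le h.integrable,
    Nat.descFactorial_eq_factorial_mul_choose]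
  push_cast [← Complex.Gamma_ofReal]
  field_simp

theorem isBigO_integral_numColors_sub (hC : IsPaintboxSample μ P C)
    (hP : ∀ c, ∀ᵐ ω ∂μ, P c ω ∈ Set.Icc (0 : ℝ) 1)
    (h : HasSimpleMellinPole (familyIntensity μ P) α β c A) (hα : 0 < α) (hβα : β ≤ α)
    (hαβ : α - 1 ≤ β) (hβ : β ≠ 0) (hαc : α < c) (hc1 : c < 1) :
    (fun n : ℕ => ((∫ ω, (numColors C n ω : ℝ) ∂μ : ℝ) : ℂ) -
      (((n : ℝ) ^ α : ℝ) : ℂ) * (-Complex.Gamma (-α) * A))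
      =O[atTop] fun n : ℕ => (n : ℝ) ^ max β 0 := by
  refine (h.isBigO_sum_integral_mul_one_sub_pow_sub
    (ae_familyIntensity_mem_Ioc hC.measurable_box hP) hα hβα hαβ hαc hc1 hβ).congr_left fun n => ?_
  have hα0 : (α : ℂ) ≠ 0 := by exact_mod_cast hα.ne'
  have hGamma : (Real.Gamma (1 - α) : ℂ) = -α * Complex.Gamma (-α) := by
    rw [← Complex.Gamma_add_one _ (neg_ne_zero.mpr hα0), ← Complex.Gamma_ofReal]
    push_cast
    ring_nf
  rw [hC.integral_numColors hP hc1.le h.integrable, Complex.ofReal_mul, hGamma, Complex.ofReal_div]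
  field_simp

end IsPaintboxSample

theorem IsDivision.hasSimpleMellinPole_solid {Ω₀ Ω : Type*} [MeasurableSpace Ω₀]
    [MeasurableSpace Ω] {P₀ : Measure Ω₀} [IsProbabilityMeasure P₀] {μ : Measure Ω}
    [IsProbabilityMeasure μ] {X Y : ℕ → Ω₀ → ℝ} {S : List ℕ → Ω → (ℕ → ℝ) × (ℕ → ℝ)}
    (hS : IsDivision P₀ X Y μ S) (hXY : IsSplitting P₀ X Y) {α ε δ c : ℝ}
    (hM : Malthusian (intensity P₀ X) (intensity P₀ Y) α ε) (hδ0 : 0 < δ) (hδ : δ < ε)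
    (hαc : α < c) (hc : c ≤ α + 1) :
    HasSimpleMellinPole (familyIntensity μ (solid S)) α (α - δ) c
      (-mellinTransform (intensity P₀ Y) α / deriv (mellinTransform (intensity P₀ X)) α) := by
  have hX1 := hM.integral_rpow_lt_one hXY.ae_intensity_X_mem_Ioc hαc
  have hX := hM.psi_finite c ((sub_lt_self α hM.eps_pos).trans hαc)
  have hY := hM.integrable_rpow_phi hXY.ae_intensity_Y_mem_Ioc
    ((sub_lt_self α hM.eps_pos).trans hαc).le
  have hc0 : 0 < c := (hXY.exponent_pos hM).trans hαc
  exact hM.hasSimpleMellinPole hXY.ae_intensity_X_mem_Ioc hXY.ae_intensity_Y_mem_Ioc hδ0 hδ hαc hc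
    (hS.integrable_rpow_solid hXY hc0 hX hX1 hY)
    (by rintro s rfl; exact hS.mellinTransform_solid hXY hc0 hX hX1)

-- When `δ = α`, summing the remainders `k ^ (α - δ - 1)` would cost a logarithm; a slightly larger
-- width avoids it.
theorem exists_width_max_sub_eq {α ε δ : ℝ} (hα : α < 1) (hδ0 : 0 < δ) (hδ : δ < ε)
    (hδα : δ ≤ α) :
    ∃ δ', 0 < δ' ∧ δ' < ε ∧ δ' ≤ 1 ∧ α - δ' ≠ 0 ∧ max (α - δ') 0 = α - δ := by
  rcases hδα.lt_or_eq with hlt | rfl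
  · exact ⟨δ, hδ0, hδ, (hδα.trans_lt hα).le, (sub_pos.mpr hlt).ne',
      max_eq_left (sub_nonneg.mpr hδα)⟩
  · obtain ⟨δ', hδ', hmin⟩ := exists_between (lt_min hδ hα)
    obtain ⟨hε, h1⟩ := lt_min_iff.mp hmin
    exact ⟨δ', hδ0.trans hδ', hε, h1.le, (sub_neg.mpr hδ').ne,
      by rw [max_eq_right (sub_neg.mpr hδ').le, sub_self]⟩

end Asymptotics

end RecursivePartition

theorem theorem1 {Ω₀ Ω : Type*} [MeasurableSpace Ω₀] [MeasurableSpace Ω]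
    (P₀ : Measure Ω₀) [IsProbabilityMeasure P₀] (μ : Measure Ω) [IsProbabilityMeasure μ]
    (X Y : ℕ → Ω₀ → ℝ) (hXY : IsSplitting P₀ X Y)
    (S : List ℕ → Ω → (ℕ → ℝ) × (ℕ → ℝ)) (hS : IsDivision P₀ X Y μ S)
    (C : ℕ → Ω → List ℕ × ℕ) (hC : IsPaintboxSample μ (solid S) C)
    (ψ φ : ℂ → ℂ) (hψ : ψ = mellinTransform (intensity P₀ X))
    (hφ : φ = mellinTransform (intensity P₀ Y))
    (α ε : ℝ) (hM : Malthusian (intensity P₀ X) (intensity P₀ Y) α ε) :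
    (0 < α ∧ α < 1) ∧
    (DifferentiableAt ℂ ψ (α : ℂ) ∧ deriv ψ (α : ℂ) ≠ 0) ∧
    (∀ δ : ℝ, 0 < δ → δ < ε → δ ≤ α →
      (fun n : ℕ => ((∫ ω, (numColors C n ω : ℝ) ∂μ : ℝ) : ℂ)
          - (((n : ℝ) ^ α : ℝ) : ℂ) * (Complex.Gamma (-(α : ℂ)) * φ α / deriv ψ α))
        =O[atTop] fun n : ℕ => (n : ℝ) ^ (α - δ)) ∧
    (∀ r : ℕ, 1 ≤ r → ∀ δ : ℝ, 0 < δ → δ < ε → δ ≤ 1 →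
      (fun n : ℕ => ((∫ ω, (numColorsMult C n r ω : ℝ) ∂μ : ℝ) : ℂ)
          - (((n : ℝ) ^ α : ℝ) : ℂ) *
            (Complex.Gamma ((r : ℂ) - α) * φ α / (-(r.factorial : ℂ) * deriv ψ α)))
        =O[atTop] fun n : ℕ => (n : ℝ) ^ (α - δ)) := by
  subst hψ hφ
  have hα0 := hXY.exponent_pos hM
  have hα1 := hXY.exponent_lt_one hM
  have hP := hS.ae_solid_mem_Icc hXY
  obtain ⟨c, hαc, hc1⟩ := exists_between hα1
  have hcα : c ≤ α + 1 := by linarith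
  refine ⟨⟨hα0, hα1⟩, ⟨hM.differentiableAt_psi (ae_familyIntensity_pos P₀ X) ?_,
    hM.deriv_psi_ne_zero hXY.ae_intensity_X_mem_Ioc⟩, ?_, ?_⟩
  · simpa using hM.eps_pos
  · intro δ hδ0 hδ hδα
    obtain ⟨δ', hδ'0, hδ', hδ'1, hne, hmax⟩ := exists_width_max_sub_eq hα1 hδ0 hδ hδα
    have hpole := hS.hasSimpleMellinPole_solid hXY hM hδ'0 hδ' hαc hcα
    rw [← hmax]
    refine (hC.isBigO_integral_numColors_sub hP hpole hα0 (by linarith) (by linarith) hne hαc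
      hc1).congr_left fun n => ?_
    ring
  · intro r hr δ hδ0 hδ hδ1
    have hpole := hS.hasSimpleMellinPole_solid hXY hM hδ0 hδ hαc hcα
    have hcr : c < r := hc1.trans_le (by exact_mod_cast hr)
    refine (hC.isBigO_integral_numColorsMult_sub hP hpole (by linarith) (by linarith) hαc
      (Nat.one_le_iff_ne_zero.mp hr) hcr).congr_left fun n => ?_
    field_simp
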